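/- Let $n \geq 2$. Make the group algebra $\mathbb{C}S_n$ into a superalgebra ($\mathbb{Z}/2$-graded algebra) whose even and odd parts are spanned by the even and the odd permutations. For a partition $\lambda \vdash n$, let $\lambda'$ be its conjugate, let $S^\lambda$ be the Specht module (realized, for instance, as the left ideal of $\mathbb{C}S_n$ generated by the Young symmetrizer of a tableau of shape $\lambda$), and let $f^\lambda = \dim_{\mathbb{C}} S^\lambda$. Fix a set $\overline{\mathcal{P}}(n)$ of representatives for the classes $\{\lambda,\lambda'\}$ of partitions of $n$, and set $$E_n = \{\lambda \in \overline{\mathcal{P}}(n) : \lambda \neq \lambda'\}, \qquad F_n = \{\lambda \in \overline{\mathcal{P}}(n) : \lambda = \lambda'\}.$$ There exist linear isomorphisms $\phi^\lambda : S^\lambda \to S^{\lambda'}$ ($\lambda \vdash n$) such that $\phi^\lambda(\sigma v) = \operatorname{sgn}(\sigma)\, \sigma \phi^\lambda(v)$ for all $\sigma \in S_n$ and $v \in S^\lambda$, and $\phi^{\lambda'} \circ \phi^\lambda = \mathrm{id}_{S^\lambda}$. Fix any such family. For $\lambda \in E_n$ let $W^\lambda = S^\lambda \oplus S^{\lambda'}$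 with even part $\{u + \phi^\lambda(u) : u \in S^\lambda\}$ and odd part $\{u - \phi^\lambda(u) : u \in S^\lambda\}$, let $J^\lambda$ be the odd involution of $W^\lambda$ with $J^\lambda(u \pm \phi^\lambda(u)) = u \mp \phi^\lambda(u)$ for $u \in S^\lambda$, and let $Q(W^\lambda) = \{\theta \in \operatorname{End}_{\mathbb{C}}(W^\lambda) : J^\lambda \theta = \theta J^\lambda\}$. For $\lambda \in F_n$ let $W^\lambda = S^\lambda$ with even and odd parts the eigenspaces of $\phi^\lambda$ for the eigenvalues $1$ and $-1$. Then each $W^\lambda$ is a simple $\mathbb{C}S_n$-supermodule, which is reducible as an ungraded module if $\lambda \in E_n$ (Type Q) and simple as an ungraded module if $\lambda \in F_n$ (Type M). Moreover, $f^\lambda$ is even for $\lambda \in F_n$, and the map $\sigma \mapsto \bigoplus_{\lambda} W^\lambda(\sigma)$, where $W^\lambda(\sigma)$ is the action of $\sigma$ on $W^\lambda$, induces a superalgebra isomorphism $$\mathbb{C}S_n \cong \Big[\bigoplus_{\lambda \in E_n} Q(W^\lambda)\Big] \oplus \Big[\bigoplus_{\lambda \in F_n} \operatorname{End}(W^\lambda)\Big]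 \cong \Big[\bigoplus_{\lambda \in E_n} Q(f^\lambda)\Big] \oplus \Big[\bigoplus_{\lambda \in F_n} M(\tfrac12 f^\lambda | \tfrac12 f^\lambda)\Big],$$ where the second isomorphism is a direct sum of superalgebra isomorphisms $Q(W^\lambda) \cong Q(f^\lambda)$ and $\operatorname{End}(W^\lambda) \cong M(\tfrac12 f^\lambda | \tfrac12 f^\lambda)$. Here $M(m|m)$ is the superalgebra of block matrices $\begin{bmatrix} A & B \\ C & D \end{bmatrix}$ with $A,B,C,D \in M_m(\mathbb{C})$, with even part $B = C = 0$ and odd part $A = D = 0$, and $Q(m) \subseteq M(m|m)$ is the subsuperalgebra of the matrices $\begin{bmatrix} A & B \\ B & A \end{bmatrix}$. Consequently, if $\operatorname{Lie}(A)$ denotes a superalgebra $A$ considered as a Lie superalgebra via the super commutator $[x,y] = xy - (-1)^{\bar{x} \cdot \bar{y}} yx$, and if $\mathfrak{q}(W^\lambda)$, $\mathfrak{gl}(W^\lambda)$, $\mathfrak{q}(m)$, $\mathfrak{gl}(m|m)$ denote $Q(W^\lambda)$, $\operatorname{End}(W^\lambda)$, $Q(m)$, $M(m|m)$ considered as Lie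 superalgebras in this way, then the same maps are isomorphisms of Lie superalgebras $$\operatorname{Lie}(\mathbb{C}S_n) \cong \Big[\bigoplus_{\lambda \in E_n} \mathfrak{q}(W^\lambda)\Big] \oplus \Big[\bigoplus_{\lambda \in F_n} \mathfrak{gl}(W^\lambda)\Big] \cong \Big[\bigoplus_{\lambda \in E_n} \mathfrak{q}(f^\lambda)\Big] \oplus \Big[\bigoplus_{\lambda \in F_n} \mathfrak{gl}(\tfrac12 f^\lambda | \tfrac12 f^\lambda)\Big].$$ -/

import Mathlib

noncomputable section

namespace SymSuper

/-! ### Superspaces -/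

/-- A complex vector superspace: a vector space `V = V₀ ⊕ V₁` graded by `ℤ/2ℤ`. -/
class Superspace (V : Type*) [AddCommGroup V] [Module ℂ V] where
  /-- The homogeneous subspaces. -/
  part : ZMod 2 → Submodule ℂ V
  isCompl : IsCompl (part 0) (part 1)


theorem isCompl_of_decomp {V : Type*} [AddCommGroup V] [Module ℂ V] {p q : Submodule ℂ V}
    (h₁ : ∀ v, v ∈ p → v ∈ q → v = 0) (h₂ : ∀ v, ∃ a ∈ p, ∃ b ∈ q, a + b = v) : IsCompl p q :=
  ⟨Submodule.disjoint_def.2 h₁, codisjoint_iff.2 <| by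
    rw [eq_top_iff]
    intro v _
    exact Submodule.mem_sup.2 (h₂ v)⟩

section Superspace

variable {V : Type*} [AddCommGroup V] [Module ℂ V] [Superspace V]

theorem isCompl_part (i : ZMod 2) :
    IsCompl (Superspace.part (V := V) i) (Superspace.part (i + 1)) := by
  fin_cases i
  · exact Superspace.isCompl
  · exact Superspace.isCompl.symm

/-- The projection of a superspace onto its homogeneous subspace of degree `i`, along the other
homogeneous subspace. -/
def proj (i : ZMod 2) : V →ₗ[ℂ] V :=
  (Superspace.part i).projection (Superspace.part (i + 1)) (isCompl_part i)

theorem proj_mem (i : ZMod 2) (v : V) : proj i v ∈ Superspace.part (V := V) i :=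
  Submodule.projection_apply_mem _ _

theorem proj_of_mem {i : ZMod 2} {v : V} (hv : v ∈ Superspace.part (V := V) i) :
    proj i v = v :=
  Submodule.projection_apply_of_mem_left _ hv

theorem proj_of_mem_ne {i j : ZMod 2} (hij : i ≠ j) {v : V}
    (hv : v ∈ Superspace.part (V := V) j) : proj i v = 0 := by
  have h : j = i + 1 := (by decide : ∀ i j : ZMod 2, i ≠ j → j = i + 1) i j hij
  subst h
  exact (Submodule.projection_apply_eq_zero_iff _).2 hv

theorem proj_zero_add_proj_one (v : V) : proj 0 v + proj 1 v = v := by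
  obtain ⟨a, ha, b, hb, rfl⟩ : ∃ a ∈ Superspace.part (V := V) 0, ∃ b ∈ Superspace.part (V := V) 1,
      a + b = v := by
    apply Submodule.mem_sup.1
    rw [(Superspace.isCompl (V := V)).sup_eq_top]
    trivial
  simp [proj_of_mem ha, proj_of_mem hb, proj_of_mem_ne (i := 0) (j := 1) (by decide) hb,
    proj_of_mem_ne (i := 1) (j := 0) (by decide) ha]

theorem eq_zero_of_mem_both {v : V} (h₀ : v ∈ Superspace.part (V := V) 0)
    (h₁ : v ∈ Superspace.part (V := V) 1) : v = 0 :=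
  Submodule.disjoint_def.1 (Superspace.isCompl (V := V)).disjoint v h₀ h₁

end Superspace

theorem proj_eq {V : Type*} [AddCommGroup V] [Module ℂ V] [Superspace V] {i : ZMod 2} {v a : V}
    (h : a ∈ Superspace.part (V := V) i) (h' : v - a ∈ Superspace.part (V := V) (i + 1)) :
    proj i v = a := by
  have e : v = a + (v - a) := by abel
  have hne : i ≠ i + 1 := (by decide : ∀ i : ZMod 2, i ≠ i + 1) i
  rw [e, map_add, proj_of_mem h, proj_of_mem_ne hne h', add_zero]

/-- The direct product of a family of superspaces (their direct sum, for a finite family). -/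
instance piSuperspace {ι : Type*} (V : ι → Type*) [∀ k, AddCommGroup (V k)]
    [∀ k, Module ℂ (V k)] [∀ k, Superspace (V k)] : Superspace (∀ k, V k) where
  part i := Submodule.pi Set.univ fun k => Superspace.part (V := V k) i
  isCompl := by
    refine isCompl_of_decomp (fun v h₀ h₁ => ?_) (fun v => ?_)
    · funext k
      exact eq_zero_of_mem_both (h₀ k trivial) (h₁ k trivial)
    · exact ⟨fun k => proj 0 (v k), fun k _ => proj_mem 0 _, fun k => proj 1 (v k),
        fun k _ => proj_mem 1 _, funext fun k => proj_zero_add_proj_one (v k)⟩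

instance prodSuperspace (V W : Type*) [AddCommGroup V] [Module ℂ V] [Superspace V]
    [AddCommGroup W] [Module ℂ W] [Superspace W] : Superspace (V × W) where
  part i := (Superspace.part (V := V) i).prod (Superspace.part (V := W) i)
  isCompl := by
    refine isCompl_of_decomp (fun v h₀ h₁ => ?_) (fun v => ?_)
    · exact Prod.ext (eq_zero_of_mem_both h₀.1 h₁.1) (eq_zero_of_mem_both h₀.2 h₁.2)
    · exact ⟨(proj 0 v.1, proj 0 v.2), ⟨proj_mem 0 _, proj_mem 0 _⟩,
        (proj 1 v.1, proj 1 v.2), ⟨proj_mem 1 _, proj_mem 1 _⟩,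
        Prod.ext (proj_zero_add_proj_one v.1) (proj_zero_add_proj_one v.2)⟩

/-! ### Associative superalgebras -/

/-- An associative unital complex superalgebra. -/
class Superalgebra (A : Type*) [Ring A] [Algebra ℂ A] extends Superspace A where
  one_mem : (1 : A) ∈ part 0
  mul_mem : ∀ {i j : ZMod 2} {a b : A}, a ∈ part i → b ∈ part j → a * b ∈ part (i + j)

instance piSuperalgebra {ι : Type*} (A : ι → Type*) [∀ k, Ring (A k)] [∀ k, Algebra ℂ (A k)]
    [∀ k, Superalgebra (A k)] : Superalgebra (∀ k, A k) where
  toSuperspace := piSuperspace A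
  one_mem := fun _ _ => Superalgebra.one_mem
  mul_mem ha hb := fun k hk => Superalgebra.mul_mem (ha k hk) (hb k hk)

instance prodSuperalgebra (A B : Type*) [Ring A] [Algebra ℂ A] [Superalgebra A]
    [Ring B] [Algebra ℂ B] [Superalgebra B] : Superalgebra (A × B) where
  toSuperspace := prodSuperspace A B
  one_mem := ⟨Superalgebra.one_mem, Superalgebra.one_mem⟩
  mul_mem ha hb := ⟨Superalgebra.mul_mem ha.1 hb.1, Superalgebra.mul_mem ha.2 hb.2⟩

/-- A subalgebra that contains the homogeneous components of its elements is a superalgebra. -/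
abbrev Superalgebra.ofSubalgebra {A : Type*} [Ring A] [Algebra ℂ A] [Superalgebra A]
    (S : Subalgebra ℂ A) (hS : ∀ x ∈ S, ∀ i, proj i x ∈ S) : Superalgebra S where
  part i := (Superspace.part (V := A) i).comap S.val.toLinearMap
  isCompl := by
    refine isCompl_of_decomp (fun v h₀ h₁ => ?_) (fun v => ?_)
    · exact Subtype.ext (eq_zero_of_mem_both (V := A) h₀ h₁)
    · exact ⟨⟨proj 0 v.1, hS v.1 v.2 0⟩, proj_mem (V := A) 0 _,
        ⟨proj 1 v.1, hS v.1 v.2 1⟩, proj_mem (V := A) 1 _,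
        Subtype.ext (proj_zero_add_proj_one v.1)⟩
  one_mem := Superalgebra.one_mem (A := A)
  mul_mem ha hb := Superalgebra.mul_mem (A := A) ha hb

/-- An isomorphism of superalgebras: an even isomorphism of algebras. -/
structure SuperalgEquiv (A B : Type*) [Ring A] [Algebra ℂ A] [Superalgebra A]
    [Ring B] [Algebra ℂ B] [Superalgebra B] extends A ≃ₐ[ℂ] B where
  map_part : ∀ (i : ZMod 2) (a : A), a ∈ Superspace.part (V := A) i →
    toFun a ∈ Superspace.part (V := B) i

/-! ### The superalgebras `End(V)` and `Q(V, J)` -/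

/-- `End(V)`, where a homogeneous map of degree `i` shifts degrees by `i`. -/
instance endSuperalgebra (V : Type*) [AddCommGroup V] [Module ℂ V] [Superspace V] :
    Superalgebra (Module.End ℂ V) where
  part i :=
    { carrier := {f | ∀ j, ∀ v ∈ Superspace.part (V := V) j, f v ∈ Superspace.part (V := V) (i + j)}
      add_mem' := fun hf hg j v hv => add_mem (hf j v hv) (hg j v hv)
      zero_mem' := fun _ _ _ => zero_mem _
      smul_mem' := fun c _ hf j v hv => Submodule.smul_mem _ c (hf j v hv) }
  isCompl := by
    refine isCompl_of_decomp (fun f h₀ h₁ => ?_) (fun f => ?_)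
    · have key : ∀ j, ∀ v ∈ Superspace.part (V := V) j, f v = 0 := by
        intro j v hv
        have a := h₀ j v hv
        have b := h₁ j v hv
        fin_cases j
        · exact eq_zero_of_mem_both a b
        · exact eq_zero_of_mem_both b a
      ext v
      rw [← proj_zero_add_proj_one v, map_add, key 0 _ (proj_mem 0 v), key 1 _ (proj_mem 1 v)]
      simp
    · refine ⟨proj 0 ∘ₗ f ∘ₗ proj 0 + proj 1 ∘ₗ f ∘ₗ proj 1, ?_,
        proj 1 ∘ₗ f ∘ₗ proj 0 + proj 0 ∘ₗ f ∘ₗ proj 1, ?_, ?_⟩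
      · intro j v hv
        fin_cases j
        · have h := proj_of_mem_ne (i := 1) (j := 0) (by decide) hv
          simp only [LinearMap.add_apply, LinearMap.comp_apply, h, map_zero, add_zero]
          exact proj_mem (V := V) 0 _
        · have h := proj_of_mem_ne (i := 0) (j := 1) (by decide) hv
          simp only [LinearMap.add_apply, LinearMap.comp_apply, h, map_zero, zero_add]
          exact proj_mem (V := V) 1 _
      · intro j v hv
        fin_cases j
        · have h := proj_of_mem_ne (i := 1) (j := 0) (by decide) hv
          simp only [LinearMap.add_apply, LinearMap.comp_apply, h, map_zero, add_zero]
          exact proj_mem (V := V) 1 _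
        · have h := proj_of_mem_ne (i := 0) (j := 1) (by decide) hv
          simp only [LinearMap.add_apply, LinearMap.comp_apply, h, map_zero, zero_add]
          exact proj_mem (V := V) 0 _
      · ext v
        have e : f v = f (proj 0 v) + f (proj 1 v) := by
          rw [← map_add, proj_zero_add_proj_one]
        have e₀ := proj_zero_add_proj_one (f (proj 0 v))
        have e₁ := proj_zero_add_proj_one (f (proj 1 v))
        simp only [LinearMap.add_apply, LinearMap.comp_apply]
        calc _ = (proj 0 (f (proj 0 v)) + proj 1 (f (proj 0 v))) +
              (proj 0 (f (proj 1 v)) + proj 1 (f (proj 1 v))) := by abel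
          _ = f v := by rw [e₀, e₁, e]
  one_mem := fun j v hv => by simpa using hv
  mul_mem {i j f g} hf hg := fun k v hv => by
    have := hf _ _ (hg k v hv)
    rwa [← add_assoc] at this

/-- An odd involution `J` of a superspace: an odd linear map with `J ∘ J = id`. -/
structure OddInvolution (V : Type*) [AddCommGroup V] [Module ℂ V] [Superspace V] where
  toEnd : Module.End ℂ V
  odd : toEnd ∈ Superspace.part (V := Module.End ℂ V) 1
  sq : toEnd * toEnd = 1

/-- `Q(V, J)`: the endomorphisms of `V` that commute with `J`. -/
def QEnd {V : Type*} [AddCommGroup V] [Module ℂ V] [Superspace V] (J : OddInvolution V) :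
    Subalgebra ℂ (Module.End ℂ V) :=
  Subalgebra.centralizer ℂ {J.toEnd}

theorem commute_proj {A : Type*} [Ring A] [Algebra ℂ A] [Superalgebra A] {u x : A}
    (hu : u ∈ Superspace.part (V := A) 1) (hc : u * x = x * u) (i : ZMod 2) :
    u * proj i x = proj i x * u := by
  have hx := proj_zero_add_proj_one x
  have m₀ := proj_mem 0 x
  have m₁ := proj_mem 1 x
  generalize proj 0 x = a at *
  generalize proj 1 x = b at *
  subst hx
  have ha : u * a - a * u ∈ Superspace.part (V := A) 1 :=
    sub_mem (by simpa using Superalgebra.mul_mem hu m₀) (by simpa using Superalgebra.mul_mem m₀ hu)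
  have hb : u * b - b * u ∈ Superspace.part (V := A) 0 :=
    sub_mem (Superalgebra.mul_mem hu m₁) (Superalgebra.mul_mem m₁ hu)
  have hab : u * a - a * u = -(u * b - b * u) := by
    rw [mul_add, add_mul] at hc
    rw [eq_neg_iff_add_eq_zero, sub_add_sub_comm, hc, sub_self]
  have h₀ : u * a - a * u = 0 := eq_zero_of_mem_both (by rw [hab]; exact neg_mem hb) ha
  have h₁ : u * b - b * u = 0 := by rw [h₀] at hab; exact neg_eq_zero.1 hab.symm
  have hi : i = 0 ∨ i = 1 := (by decide : ∀ i : ZMod 2, i = 0 ∨ i = 1) i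
  rcases hi with rfl | rfl
  · rw [map_add, proj_of_mem m₀, proj_of_mem_ne (by decide) m₁, add_zero]
    exact sub_eq_zero.1 h₀
  · rw [map_add, proj_of_mem m₁, proj_of_mem_ne (by decide) m₀, zero_add]
    exact sub_eq_zero.1 h₁

instance qEndSuperalgebra {V : Type*} [AddCommGroup V] [Module ℂ V] [Superspace V]
    (J : OddInvolution V) : Superalgebra (QEnd J) :=
  Superalgebra.ofSubalgebra (QEnd J) <| by
    intro x hx i
    refine (Subalgebra.mem_centralizer_iff ℂ).2 ?_
    rintro _ rfl
    exact commute_proj J.odd ((Subalgebra.mem_centralizer_iff ℂ).1 hx _ rfl) i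

/-! ### The matrix superalgebras `M(m|n)` and `Q(n)` -/

/-- The degree of the rows and columns of a supermatrix. -/
def blockDeg {m n : ℕ} : Fin m ⊕ Fin n → ZMod 2 := Sum.elim (fun _ => 0) (fun _ => 1)

/-- `M(m|n)`: block matrices `[A B; C D]`. -/
abbrev MSuper (m n : ℕ) : Type := Matrix (Fin m ⊕ Fin n) (Fin m ⊕ Fin n) ℂ

/-- `[A 0; 0 D]` is even and `[0 B; C 0]` is odd. -/
instance mSuperalgebra (m n : ℕ) : Superalgebra (MSuper m n) where
  part i :=
    { carrier := {M | ∀ r c, blockDeg r + blockDeg c ≠ i → M r c = 0}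
      add_mem' := fun hM hN r c h => by simp [hM r c h, hN r c h]
      zero_mem' := fun _ _ _ => rfl
      smul_mem' := fun z M hM r c h => by simp [hM r c h] }
  isCompl := by
    refine isCompl_of_decomp (fun M h₀ h₁ => ?_) (fun M => ?_)
    · ext r c
      by_cases h : blockDeg r + blockDeg c = 0
      · exact h₁ r c (by rw [h]; decide)
      · exact h₀ r c h
    · refine ⟨fun r c => if blockDeg r + blockDeg c = 0 then M r c else 0, fun r c h => if_neg h,
        fun r c => if blockDeg r + blockDeg c = 0 then 0 else M r c, fun r c h => if_pos ?_, ?_⟩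
      · exact (by decide : ∀ x : ZMod 2, x ≠ 1 → x = 0) _ h
      · ext r c
        by_cases h : blockDeg r + blockDeg c = 0
        · exact (congrArg₂ (· + ·) (if_pos h) (if_pos h)).trans (add_zero _)
        · exact (congrArg₂ (· + ·) (if_neg h) (if_neg h)).trans (zero_add _)
  one_mem := fun r c h => by
    refine Matrix.one_apply_ne ?_
    rintro rfl
    exact h ((by decide : ∀ x : ZMod 2, x + x = 0) _)
  mul_mem {i j M N} hM hN := fun r c h => by
    rw [Matrix.mul_apply]
    refine Finset.sum_eq_zero fun k _ => ?_
    by_cases h₁ : blockDeg r + blockDeg k = i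
    · have h₂ : blockDeg k + blockDeg c ≠ j := by
        rintro rfl
        exact h ((by decide : ∀ x y z i : ZMod 2, x + y = i → x + z = i + (y + z)) _ _ _ _ h₁)
      rw [hN k c h₂, mul_zero]
    · rw [hM r k h₁, zero_mul]

/-- `Q(n)`: block matrices `[A B; B A]`. -/
def QSuper (n : ℕ) : Subalgebra ℂ (MSuper n n) where
  carrier := {M | ∃ A B : Matrix (Fin n) (Fin n) ℂ, M = Matrix.fromBlocks A B B A}
  add_mem' := by
    rintro _ _ ⟨A, B, rfl⟩ ⟨C, D, rfl⟩
    exact ⟨A + C, B + D, Matrix.fromBlocks_add ..⟩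
  mul_mem' := by
    rintro _ _ ⟨A, B, rfl⟩ ⟨C, D, rfl⟩
    refine ⟨A * C + B * D, A * D + B * C, ?_⟩
    rw [Matrix.fromBlocks_multiply, add_comm (B * C), add_comm (B * D)]
  algebraMap_mem' := by
    intro r
    refine ⟨r • 1, 0, ?_⟩
    rw [Algebra.algebraMap_eq_smul_one, ← Matrix.fromBlocks_one, Matrix.fromBlocks_smul, smul_zero]

instance qSuperalgebra (n : ℕ) : Superalgebra (QSuper n) :=
  Superalgebra.ofSubalgebra (QSuper n) <| by
    rintro _ ⟨A, B, rfl⟩ i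
    have h₀ : Matrix.fromBlocks A 0 0 A ∈ Superspace.part (V := MSuper n n) 0 := by
      rintro (r | r) (c | c) h <;> first | rfl | exact absurd rfl h
    have h₁ : Matrix.fromBlocks 0 B B 0 ∈ Superspace.part (V := MSuper n n) 1 := by
      rintro (r | r) (c | c) h <;> first | rfl | exact absurd rfl h
    have e : Matrix.fromBlocks A B B A =
        Matrix.fromBlocks A 0 0 A + Matrix.fromBlocks 0 B B 0 := by
      rw [Matrix.fromBlocks_add]; simp
    fin_cases i
    · refine ⟨A, 0, proj_eq (V := MSuper n n) h₀ ?_⟩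
      rw [e, add_sub_cancel_left]
      exact h₁
    · refine ⟨0, B, proj_eq (V := MSuper n n) h₁ ?_⟩
      rw [e, add_sub_cancel_right]
      exact h₀

/-! ### Lie superalgebras -/

/-- The sign `(-1)^{i j}`. -/
def ksign (i j : ZMod 2) : ℂ := (-1) ^ (i.val * j.val)

/-- A complex Lie superalgebra. -/
class LieSuperalgebra (L : Type*) [AddCommGroup L] [Module ℂ L] extends Superspace L where
  bracket : L →ₗ[ℂ] L →ₗ[ℂ] L
  bracket_mem : ∀ {i j : ZMod 2} {x y : L}, x ∈ part i → y ∈ part j → bracket x y ∈ part (i + j)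
  skew : ∀ {i j : ZMod 2} {x y : L}, x ∈ part i → y ∈ part j →
    bracket x y = -(ksign i j • bracket y x)
  jacobi : ∀ {i j k : ZMod 2} {x y z : L}, x ∈ part i → y ∈ part j → z ∈ part k →
    bracket x (bracket y z) = bracket (bracket x y) z + ksign i j • bracket y (bracket x z)

instance piLieSuperalgebra {ι : Type*} (L : ι → Type*) [∀ k, AddCommGroup (L k)]
    [∀ k, Module ℂ (L k)] [∀ k, LieSuperalgebra (L k)] : LieSuperalgebra (∀ k, L k) where
  toSuperspace := piSuperspace L
  bracket := LinearMap.mk₂ ℂ (fun x y k => LieSuperalgebra.bracket (x k) (y k))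
    (fun _ _ _ => by ext; simp) (fun _ _ _ => by ext; simp)
    (fun _ _ _ => by ext; simp) (fun _ _ _ => by ext; simp)
  bracket_mem hx hy := fun k hk => LieSuperalgebra.bracket_mem (hx k hk) (hy k hk)
  skew hx hy := funext fun k => LieSuperalgebra.skew (hx k trivial) (hy k trivial)
  jacobi hx hy hz :=
    funext fun k => LieSuperalgebra.jacobi (hx k trivial) (hy k trivial) (hz k trivial)

instance prodLieSuperalgebra (L M : Type*) [AddCommGroup L] [Module ℂ L] [LieSuperalgebra L]
    [AddCommGroup M] [Module ℂ M] [LieSuperalgebra M] : LieSuperalgebra (L × M) where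
  toSuperspace := prodSuperspace L M
  bracket := LinearMap.mk₂ ℂ
    (fun x y => (LieSuperalgebra.bracket x.1 y.1, LieSuperalgebra.bracket x.2 y.2))
    (fun _ _ _ => by ext <;> simp) (fun _ _ _ => by ext <;> simp)
    (fun _ _ _ => by ext <;> simp) (fun _ _ _ => by ext <;> simp)
  bracket_mem hx hy :=
    ⟨LieSuperalgebra.bracket_mem hx.1 hy.1, LieSuperalgebra.bracket_mem hx.2 hy.2⟩
  skew hx hy := Prod.ext (LieSuperalgebra.skew hx.1 hy.1) (LieSuperalgebra.skew hx.2 hy.2)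
  jacobi hx hy hz :=
    Prod.ext (LieSuperalgebra.jacobi hx.1 hy.1 hz.1) (LieSuperalgebra.jacobi hx.2 hy.2 hz.2)

/-- An isomorphism of Lie superalgebras: an even linear isomorphism that respects brackets. -/
structure LieSuperEquiv (L M : Type*) [AddCommGroup L] [Module ℂ L] [LieSuperalgebra L]
    [AddCommGroup M] [Module ℂ M] [LieSuperalgebra M] extends L ≃ₗ[ℂ] M where
  map_part : ∀ (i : ZMod 2) (x : L), x ∈ Superspace.part (V := L) i →
    toFun x ∈ Superspace.part (V := M) i
  map_bracket : ∀ x y : L,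
    toFun (LieSuperalgebra.bracket x y) = LieSuperalgebra.bracket (toFun x) (toFun y)

/-- The bilinear extension of `[x, y] = x y - (-1)^{i j} y x`, for `x`, `y` homogeneous of degrees
`i`, `j`, to all elements of a superalgebra. -/
def superCommutator (A : Type*) [Ring A] [Algebra ℂ A] [Superalgebra A] : A →ₗ[ℂ] A →ₗ[ℂ] A :=
  LinearMap.mul ℂ A -
    ∑ i : ZMod 2, ∑ j : ZMod 2, ksign i j • (LinearMap.mul ℂ A).flip.compl₁₂ (proj i) (proj j)

theorem superCommutator_of_mem {A : Type*} [Ring A] [Algebra ℂ A] [Superalgebra A] {i j : ZMod 2}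
    {x y : A} (hx : x ∈ Superspace.part (V := A) i) (hy : y ∈ Superspace.part (V := A) j) :
    superCommutator A x y = x * y - ksign i j • (y * x) := by
  simp only [superCommutator, LinearMap.sub_apply, LinearMap.mul_apply', LinearMap.sum_apply,
    LinearMap.smul_apply, LinearMap.compl₁₂_apply, LinearMap.flip_apply]
  rw [Finset.sum_eq_single i, Finset.sum_eq_single j, proj_of_mem hx, proj_of_mem hy]
  · intro b _ hb
    simp [proj_of_mem_ne hb hy]
  · simp
  · intro b _ hb
    simp [proj_of_mem_ne hb hx]
  · simp

section SuperCommutator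

variable {A : Type*} [Ring A] [Algebra ℂ A] [Superalgebra A] {i j k : ZMod 2} {x y z : A}

theorem superCommutator_mem (hx : x ∈ Superspace.part (V := A) i)
    (hy : y ∈ Superspace.part (V := A) j) :
    superCommutator A x y ∈ Superspace.part (V := A) (i + j) := by
  rw [superCommutator_of_mem hx hy]
  refine sub_mem (Superalgebra.mul_mem hx hy) (Submodule.smul_mem _ _ ?_)
  rw [add_comm]
  exact Superalgebra.mul_mem hy hx

theorem ksign_cases : ksign 0 0 = 1 ∧ ksign 0 1 = 1 ∧ ksign 1 0 = 1 ∧ ksign 1 1 = -1 := by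
  simp [ksign, ZMod.val_one]

theorem superCommutator_skew (hx : x ∈ Superspace.part (V := A) i)
    (hy : y ∈ Superspace.part (V := A) j) :
    superCommutator A x y = -(ksign i j • superCommutator A y x) := by
  have hz : ∀ i : ZMod 2, i = 0 ∨ i = 1 := by decide
  obtain ⟨s₀₀, s₀₁, s₁₀, s₁₁⟩ := ksign_cases
  rw [superCommutator_of_mem hx hy, superCommutator_of_mem hy hx]
  rcases hz i with rfl | rfl <;> rcases hz j with rfl | rfl <;>
    simp only [s₀₀, s₀₁, s₁₀, s₁₁, one_smul, neg_smul] <;> abel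

theorem superCommutator_jacobi (hx : x ∈ Superspace.part (V := A) i)
    (hy : y ∈ Superspace.part (V := A) j) (hz : z ∈ Superspace.part (V := A) k) :
    superCommutator A x (superCommutator A y z) =
      superCommutator A (superCommutator A x y) z +
        ksign i j • superCommutator A y (superCommutator A x z) := by
  have hc : ∀ i : ZMod 2, i = 0 ∨ i = 1 := by decide
  have h₁₁ : (1 : ZMod 2) + 1 = 0 := rfl
  obtain ⟨s₀₀, s₀₁, s₁₀, s₁₁⟩ := ksign_cases
  rw [superCommutator_of_mem hx (superCommutator_mem hy hz),
    superCommutator_of_mem (superCommutator_mem hx hy) hz,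
    superCommutator_of_mem hy (superCommutator_mem hx hz), superCommutator_of_mem hy hz,
    superCommutator_of_mem hx hy, superCommutator_of_mem hx hz]
  rcases hc i with rfl | rfl <;> rcases hc j with rfl | rfl <;> rcases hc k with rfl | rfl <;>
    simp only [s₀₀, s₀₁, s₁₀, s₁₁, one_smul, neg_smul, add_zero, zero_add, h₁₁] <;> noncomm_ring

end SuperCommutator

/-- `Lie(A)`: the superalgebra `A`, considered as a Lie superalgebra. -/
def LieOf (A : Type*) : Type _ := A

namespace LieOf

variable (A : Type*) [Ring A] [Algebra ℂ A] [Superalgebra A]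

instance : AddCommGroup (LieOf A) := inferInstanceAs (AddCommGroup A)

instance : Module ℂ (LieOf A) := inferInstanceAs (Module ℂ A)

variable {A} in
/-- The identity map from `A` to `Lie(A)`. -/
def of : A ≃ₗ[ℂ] LieOf A := LinearEquiv.refl ℂ A

instance : LieSuperalgebra (LieOf A) where
  part := Superspace.part (V := A)
  isCompl := Superspace.isCompl (V := A)
  bracket := superCommutator A
  bracket_mem hx hy := superCommutator_mem (A := A) hx hy
  skew hx hy := superCommutator_skew (A := A) hx hy
  jacobi hx hy hz := superCommutator_jacobi (A := A) hx hy hz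

end LieOf

/-! ### Supermodules -/

/-- `V` is an `A`-supermodule: the action is compatible with the gradings. -/
def IsSupermodule (A V : Type*) [Ring A] [Algebra ℂ A] [Superalgebra A] [AddCommGroup V]
    [Module ℂ V] [Superspace V] [Module A V] [IsScalarTower ℂ A V] : Prop :=
  ∀ (i j : ZMod 2) (a : A) (v : V), a ∈ Superspace.part (V := A) i →
    v ∈ Superspace.part (V := V) j → a • v ∈ Superspace.part (V := V) (i + j)

/-- `V` is a simple `A`-supermodule: it is nonzero and has no graded submodules but `0` and `V`. -/
def IsSimpleSupermodule (A V : Type*) [Ring A] [Algebra ℂ A] [Superalgebra A] [AddCommGroup V]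
    [Module ℂ V] [Superspace V] [Module A V] [IsScalarTower ℂ A V] : Prop :=
  IsSupermodule A V ∧ Nontrivial V ∧
    ∀ U : Submodule A V, (∀ u ∈ U, ∀ i : ZMod 2, proj i u ∈ U) → U = ⊥ ∨ U = ⊤

/-- A simple supermodule of Type M stays simple when the gradings are forgotten. -/
def IsTypeM (A V : Type*) [Ring A] [Algebra ℂ A] [Superalgebra A] [AddCommGroup V]
    [Module ℂ V] [Superspace V] [Module A V] [IsScalarTower ℂ A V] : Prop :=
  IsSimpleSupermodule A V ∧ IsSimpleModule A V

/-- A simple supermodule of Type Q becomes reducible when the gradings are forgotten. -/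
def IsTypeQ (A V : Type*) [Ring A] [Algebra ℂ A] [Superalgebra A] [AddCommGroup V]
    [Module ℂ V] [Superspace V] [Module A V] [IsScalarTower ℂ A V] : Prop :=
  IsSimpleSupermodule A V ∧ ¬ IsSimpleModule A V

/-! ### The group superalgebra of the symmetric group -/

/-- The group algebra `ℂ S_n`. -/
abbrev CS (n : ℕ) : Type := MonoidAlgebra ℂ (Equiv.Perm (Fin n))

/-- The degree of a permutation: `0` if it is even and `1` if it is odd. -/
def permDeg {n : ℕ} (σ : Equiv.Perm (Fin n)) : ZMod 2 := if Equiv.Perm.sign σ = 1 then 0 else 1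

theorem permDeg_mul {n : ℕ} (σ τ : Equiv.Perm (Fin n)) :
    permDeg (σ * τ) = permDeg σ + permDeg τ := by
  rcases Int.units_eq_one_or (Equiv.Perm.sign σ) with h | h <;>
    rcases Int.units_eq_one_or (Equiv.Perm.sign τ) with h' | h' <;>
    simp [permDeg, h, h']
  decide

/-- The elements of degree `i` are the linear combinations of permutations of degree `i`. -/
instance csSuperalgebra (n : ℕ) : Superalgebra (CS n) where
  part i :=
    { carrier := {a | ∀ σ, permDeg σ ≠ i → a.coeff σ = 0}
      add_mem' := fun ha hb σ h => by simp [ha σ h, hb σ h]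
      zero_mem' := fun _ _ => rfl
      smul_mem' := fun z a ha σ h => by simp [ha σ h] }
  isCompl := by
    refine isCompl_of_decomp (fun a h₀ h₁ => ?_) (fun a => ?_)
    · ext σ
      by_cases h : permDeg σ = 0
      · exact h₁ σ (by rw [h]; decide)
      · exact h₀ σ h
    · refine ⟨.ofCoeff (a.coeff.filter fun σ => permDeg σ = 0), fun σ h => ?_,
        .ofCoeff (a.coeff.filter fun σ => ¬ permDeg σ = 0), fun σ h => ?_, ?_⟩
      · exact Finsupp.filter_apply_neg _ _ h
      · exact Finsupp.filter_apply_neg _ _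
          (not_not.2 ((by decide : ∀ x : ZMod 2, x ≠ 1 → x = 0) _ h))
      · exact congrArg MonoidAlgebra.ofCoeff (Finsupp.filter_add_filter_not _ _)
  one_mem := fun σ h => by
    have : σ ≠ 1 := by
      rintro rfl
      exact h (by simp [permDeg])
    simp [MonoidAlgebra.one_def, this.symm]
  mul_mem {i j a b} ha hb := fun σ h => by
    classical
    rw [MonoidAlgebra.coeff_mul]
    refine Finset.sum_eq_zero fun x _ => Finset.sum_eq_zero fun y _ => ?_
    dsimp only
    split_ifs with hxy
    · by_cases hx : permDeg x = i
      · have hy : permDeg y ≠ j := by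
          rintro rfl
          exact h (by rw [← hxy, permDeg_mul, hx])
        rw [hb y hy, mul_zero]
      · rw [ha x hx, zero_mul]
    · rfl

/-! ### Partitions and Specht modules -/

/-- The partitions of `n`, as Young diagrams with `n` boxes; the box `(i, j)` is in row `i` and
column `j`. -/
abbrev Ptn (n : ℕ) : Type := {μ : YoungDiagram // μ.card = n}

/-- The conjugate partition. -/
def Ptn.conj {n : ℕ} (l : Ptn n) : Ptn n :=
  ⟨l.1.transpose, by
    refine Eq.trans ?_ l.2
    simp [YoungDiagram.card, YoungDiagram.transpose]⟩

/-- A tableau of shape `l`: the entry `k` is in the box `t k`. -/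
abbrev Tableau {n : ℕ} (l : Ptn n) : Type := Fin n ≃ {c : ℕ × ℕ // c ∈ l.1.cells}

/-- The sum of the permutations that preserve the rows of the tableau `t`. -/
def rowSum {n : ℕ} {l : Ptn n} (t : Tableau l) : CS n :=
  ∑ σ : Equiv.Perm (Fin n) with ∀ k, (t (σ k)).1.1 = (t k).1.1, MonoidAlgebra.single σ 1

/-- The signed sum of the permutations that preserve the columns of the tableau `t`. -/
def colSum {n : ℕ} {l : Ptn n} (t : Tableau l) : CS n :=
  ∑ σ : Equiv.Perm (Fin n) with ∀ k, (t (σ k)).1.2 = (t k).1.2,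
    MonoidAlgebra.single σ ((Equiv.Perm.sign σ : ℤ) : ℂ)

/-- The Specht module of shape `l`, realized as the left ideal of `ℂ S_n` generated by the Young
symmetrizer of a tableau `t` of shape `l`. (The left ideal generated by `rowSum t` is the
permutation module on tabloids of shape `l`, and `colSum t * rowSum t` is the polytabloid of `t`.) -/
def Specht {n : ℕ} {l : Ptn n} (t : Tableau l) : Submodule (CS n) (CS n) :=
  Submodule.span (CS n) {colSum t * rowSum t}

/-- `f^l`, the dimension of the Specht module of shape `l`. -/
def spechtDim {n : ℕ} (T : ∀ l : Ptn n, Tableau l) (l : Ptn n) : ℕ :=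
  Module.finrank ℂ (Specht (T l))

/-- A choice of linear isomorphisms `φ^l : S^l → S^{l'}` with `φ^l (σ v) = (-1)^σ σ φ^l(v)` and such
that `φ^{l'}` and `φ^l` are mutually inverse. (All Specht modules are submodules of `ℂ S_n`, which
makes `S^{l''}` equal to `S^l`.) -/
structure Associator {n : ℕ} (T : ∀ l : Ptn n, Tableau l) where
  toFun : ∀ l : Ptn n, Specht (T l) →ₗ[ℂ] Specht (T l.conj)
  intertwines : ∀ (l : Ptn n) (σ : Equiv.Perm (Fin n)) (v : Specht (T l)),
    toFun l ((MonoidAlgebra.single σ 1 : CS n) • v) =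
      ((Equiv.Perm.sign σ : ℤ) : ℂ) • (MonoidAlgebra.single σ 1 : CS n) • toFun l v
  inverse : ∀ (l : Ptn n) (v : Specht (T l)), (toFun l.conj (toFun l v) : CS n) = v

/-! ### The supermodules `W^l` -/

section W

variable {n : ℕ} {T : ∀ l : Ptn n, Tableau l}

theorem specht_congr {l m : Ptn n} (h : m = l) : Specht (T m) = Specht (T l) := by
  subst h
  rfl

theorem Associator.congr (φ : Associator T) {l m : Ptn n} (h : m = l) (w : Specht (T m))
    (u : Specht (T l)) (hu : (w : CS n) = u) : (φ.toFun m w : CS n) = φ.toFun l u := by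
  subst h
  rw [Subtype.ext hu]

theorem Associator.injective (φ : Associator T) {l : Ptn n} {u : Specht (T l)}
    (hu : φ.toFun l u = 0) : u = 0 := by
  have h := φ.inverse l u
  rw [hu, map_zero, Submodule.coe_zero] at h
  exact Subtype.ext (h.symm.trans Submodule.coe_zero.symm)

theorem Associator.surjective (φ : Associator T) (l : Ptn n) (v : Specht (T l.conj)) :
    ∃ u : Specht (T l), φ.toFun l u = v := by
  have h : l.conj.conj = l := Subtype.ext (YoungDiagram.transpose_transpose _)
  obtain ⟨x, hx⟩ : ∃ x : Specht (T l), (φ.toFun l.conj v : CS n) = x :=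
    ⟨⟨φ.toFun l.conj v, (specht_congr (T := T) h).le (Subtype.mem _)⟩, rfl⟩
  refine ⟨x, Subtype.ext ?_⟩
  rw [← φ.congr h _ x hx]
  exact φ.inverse l.conj v

theorem Associator.exists_eq (φ : Associator T) {l : Ptn n} (h : l.conj = l) (u : Specht (T l)) :
    ∃ x : Specht (T l), (φ.toFun l u : CS n) = x ∧ (φ.toFun l x : CS n) = u := by
  obtain ⟨x, hx⟩ : ∃ x : Specht (T l), (φ.toFun l u : CS n) = x :=
    ⟨⟨φ.toFun l u, (specht_congr (T := T) h).le (Subtype.mem _)⟩, rfl⟩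
  refine ⟨x, hx, ?_⟩
  rw [← φ.congr h _ x hx]
  exact φ.inverse l u

variable (φ : Associator T) (l : Ptn n)

/-- The subspaces `{u + φ(u) : u ∈ S^l}` (for `i = 0`) and `{u - φ(u) : u ∈ S^l}` (for `i = 1`) of
`S^l ⊕ S^{l'}`. -/
def wePart (i : ZMod 2) : Submodule ℂ (Specht (T l) × Specht (T l.conj)) :=
  LinearMap.range (LinearMap.prod LinearMap.id (ksign i 1 • φ.toFun l))

theorem mem_wePart (i : ZMod 2) (w : Specht (T l) × Specht (T l.conj)) :
    w ∈ wePart φ l i ↔ w.2 = ksign i 1 • φ.toFun l w.1 := by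
  constructor
  · rintro ⟨u, rfl⟩
    rfl
  · intro h
    exact ⟨w.1, Prod.ext rfl h.symm⟩

theorem isCompl_wePart : IsCompl (wePart φ l 0) (wePart φ l 1) := by
  obtain ⟨-, s₀, -, s₁⟩ := ksign_cases
  refine isCompl_of_decomp (fun w h₀ h₁ => ?_) (fun w => ?_)
  · rw [mem_wePart] at h₀ h₁
    rw [s₀, one_smul] at h₀
    rw [s₁, neg_one_smul ℂ (φ.toFun l w.1), h₀] at h₁
    have h₂ : (2 : ℂ) • φ.toFun l w.1 = 0 := by
      rw [two_smul]
      nth_rewrite 1 [h₁]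
      exact neg_add_cancel _
    have h₃ : φ.toFun l w.1 = 0 := (smul_eq_zero_iff_right two_ne_zero).1 h₂
    exact Prod.ext (φ.injective h₃) (h₀.trans h₃)
  · obtain ⟨x, hx⟩ := φ.surjective l w.2
    refine ⟨((2⁻¹ : ℂ) • (w.1 + x), (2⁻¹ : ℂ) • φ.toFun l (w.1 + x)), ?_,
      ((2⁻¹ : ℂ) • (w.1 - x), -((2⁻¹ : ℂ) • φ.toFun l (w.1 - x))), ?_, Prod.ext ?_ ?_⟩
    · rw [mem_wePart, s₀, one_smul]
      exact (map_smul _ _ _).symm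
    · rw [mem_wePart, s₁]
      refine Eq.trans ?_ (neg_one_smul ℂ (φ.toFun l ((2⁻¹ : ℂ) • (w.1 - x)))).symm
      exact congrArg Neg.neg (map_smul _ _ _).symm
    · change (2⁻¹ : ℂ) • (w.1 + x) + (2⁻¹ : ℂ) • (w.1 - x) = w.1
      module
    · change (2⁻¹ : ℂ) • φ.toFun l (w.1 + x) + -((2⁻¹ : ℂ) • φ.toFun l (w.1 - x)) = w.2
      rw [map_add, map_sub, hx]
      module

/-- The map `J` on `S^l ⊕ S^{l'}` with `J(u ± φ(u)) = u ∓ φ(u)` for `u ∈ S^l`: the identity on `S^l`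
and minus the identity on `S^{l'}`. -/
def weJ : Module.End ℂ (Specht (T l) × Specht (T l.conj)) :=
  LinearMap.prodMap LinearMap.id (-LinearMap.id)

theorem weJ_mem (j : ZMod 2) (w : Specht (T l) × Specht (T l.conj)) (hw : w ∈ wePart φ l j) :
    weJ (T := T) l w ∈ wePart φ l (1 + j) := by
  obtain ⟨-, s₀, -, s₁⟩ := ksign_cases
  rw [mem_wePart] at hw ⊢
  change -w.2 = ksign (1 + j) 1 • φ.toFun l w.1
  have hs : ksign (1 + j) 1 = -ksign j 1 := by
    rcases (by decide : ∀ i : ZMod 2, i = 0 ∨ i = 1) j with rfl | rfl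
    · rw [add_zero, s₀, s₁]
    · rw [show (1 : ZMod 2) + 1 = 0 from rfl, s₀, s₁, neg_neg]
  rw [hs, hw]
  exact (neg_smul (ksign j 1) (φ.toFun l w.1)).symm

/-- The eigenspaces of `φ^l : S^l → S^l`, where `l = l'`, for the eigenvalues `1` (for `i = 0`) and
`-1` (for `i = 1`). -/
def wfPart (i : ZMod 2) : Submodule ℂ (Specht (T l)) where
  carrier := {u | (φ.toFun l u : CS n) = ksign i 1 • (u : CS n)}
  add_mem' {u v} hu hv := by
    simp only [Set.mem_ofPred_eq] at hu hv ⊢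
    rw [map_add, Submodule.coe_add, Submodule.coe_add, hu, hv, smul_add]
  zero_mem' := by
    simp only [Set.mem_ofPred_eq]
    rw [map_zero, Submodule.coe_zero, Submodule.coe_zero, smul_zero]
  smul_mem' c u hu := by
    simp only [Set.mem_ofPred_eq] at hu ⊢
    rw [map_smul, Submodule.coe_smul_of_tower, Submodule.coe_smul_of_tower, hu, smul_comm]

theorem isCompl_wfPart (h : l.conj = l) : IsCompl (wfPart φ l 0) (wfPart φ l 1) := by
  obtain ⟨-, s₀, -, s₁⟩ := ksign_cases
  have mem (i : ZMod 2) (u : Specht (T l)) :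
    u ∈ wfPart φ l i ↔ (φ.toFun l u : CS n) = ksign i 1 • (u : CS n) := Iff.rfl
  refine isCompl_of_decomp (fun u h₀ h₁ => ?_) (fun u => ?_)
  · rw [mem] at h₀ h₁
    rw [s₀, one_smul] at h₀
    rw [s₁, neg_one_smul, h₀] at h₁
    have h₂ : (2 : ℂ) • (u : CS n) = 0 := by
      rw [two_smul]
      nth_rewrite 1 [h₁]
      exact neg_add_cancel _
    exact Subtype.ext ((smul_eq_zero_iff_right two_ne_zero).1 h₂)
  · obtain ⟨x, hx, hx'⟩ := φ.exists_eq h u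
    refine ⟨(2⁻¹ : ℂ) • (u + x), ?_, (2⁻¹ : ℂ) • (u - x), ?_, by module⟩
    · rw [mem, map_smul, map_add, Submodule.coe_smul_of_tower, Submodule.coe_smul_of_tower,
        Submodule.coe_add, Submodule.coe_add, hx, hx', s₀]
      module
    · rw [mem, map_smul, map_sub, Submodule.coe_smul_of_tower, Submodule.coe_smul_of_tower,
        Submodule.coe_sub, Submodule.coe_sub, hx, hx', s₁]
      module

/-- For `l ≠ l'`: the supermodule `W^l = S^l ⊕ S^{l'}`. -/
def WE (_φ : Associator T) (l : Ptn n) : Type := Specht (T l) × Specht (T l.conj)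

instance : AddCommGroup (WE φ l) := inferInstanceAs (AddCommGroup (Specht (T l) × Specht (T l.conj)))

instance : Module ℂ (WE φ l) := inferInstanceAs (Module ℂ (Specht (T l) × Specht (T l.conj)))

instance : Module (CS n) (WE φ l) :=
  inferInstanceAs (Module (CS n) (Specht (T l) × Specht (T l.conj)))

instance : IsScalarTower ℂ (CS n) (WE φ l) :=
  inferInstanceAs (IsScalarTower ℂ (CS n) (Specht (T l) × Specht (T l.conj)))

instance weSuperspace : Superspace (WE φ l) where
  part := wePart φ l
  isCompl := isCompl_wePart φ l

/-- The odd involution `J^l` of `W^l`, for `l ≠ l'`. -/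
def weInvolution : OddInvolution (WE φ l) where
  toEnd := weJ (T := T) l
  odd := weJ_mem φ l
  sq := LinearMap.ext fun w => Prod.ext rfl (neg_neg w.2)

/-- For `l = l'`: the supermodule `W^l = S^l`. -/
def WF (_φ : Associator T) (l : Ptn n) (_h : l.conj = l) : Type := Specht (T l)

variable (h : l.conj = l)

instance : AddCommGroup (WF φ l h) := inferInstanceAs (AddCommGroup (Specht (T l)))

instance : Module ℂ (WF φ l h) := inferInstanceAs (Module ℂ (Specht (T l)))

instance : Module (CS n) (WF φ l h) := inferInstanceAs (Module (CS n) (Specht (T l)))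

instance : IsScalarTower ℂ (CS n) (WF φ l h) :=
  inferInstanceAs (IsScalarTower ℂ (CS n) (Specht (T l)))

instance wfSuperspace : Superspace (WF φ l h) where
  part := wfPart φ l
  isCompl := isCompl_wfPart φ l h

end W

/-! ### Representatives of partitions up to conjugation -/

/-- `P` is a set of representatives for the classes `{l, l'}` of partitions of `n`. -/
def IsConjReps {n : ℕ} (P : Set (Ptn n)) : Prop :=
  ∀ l : Ptn n, ∃! m : Ptn n, m ∈ P ∧ (m = l ∨ m = l.conj)

/-- `E_n`: the representatives `l` with `l ≠ l'`. -/
abbrev EReps {n : ℕ} (P : Set (Ptn n)) : Type := {l : Ptn n // l ∈ P ∧ l.conj ≠ l}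

/-- `F_n`: the representatives `l` with `l = l'`. -/
abbrev FReps {n : ℕ} (P : Set (Ptn n)) : Type := {l : Ptn n // l ∈ P ∧ l.conj = l}

section Targets

variable {n : ℕ} {T : ∀ l : Ptn n, Tableau l}

/-- `Q(W^l) = Q(W^l, J^l)` for `l ∈ E_n`. -/
abbrev QW (φ : Associator T) {P : Set (Ptn n)} (l : EReps P) :
    Subalgebra ℂ (Module.End ℂ (WE φ l.1)) :=
  QEnd (weInvolution φ l.1)

/-- `End(W^l)` for `l ∈ F_n`. -/
abbrev EndW (φ : Associator T) {P : Set (Ptn n)} (l : FReps P) : Type :=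
  Module.End ℂ (WF φ l.1 l.2.2)

end Targets

end SymSuper
end

open SymSuper

/-!
A Young symmetrizer `e` satisfies `e A e = ℂ e` in the semisimple algebra `A = ℂ S_n`, so the left
ideal `A e` is simple. If a tableau `s` has more boxes than `t` in its first `i` rows, then some two
entries share a column of `t` and a row of `s`, and the transposition of such entries shows that the
column sum of `t` kills the Specht module of `s` but not its own. The Specht modules are therefore
pairwise non-isomorphic, and since there are as many of them as conjugacy classes, `A` is the
product of the algebras `End(S^λ)`.

The sign automorphism of `A` exchanges row and column sums, so followed by a suitable right
multiplication it maps `S^λ` to `S^{λ'}`; these maps are mutually inverse up to scalars, which a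
square root removes. An endomorphism of `S^λ ⊕ S^{λ'}` commutes with `J^λ` if and only if it
preserves both summands, so the factors of `λ` and `λ'` combine to `Q(W^λ)`. A transposition acts on
each `W^λ` as an odd involution, so the even and odd parts have equal dimension, which makes `f^λ`
even for `λ = λ'`.
-/

noncomputable section
namespace SymSuper

section GroupAlgebra

open MonoidAlgebra (single single_mul_single)
open scoped MonoidAlgebra

variable {k G : Type*}

theorem coeff_one_mul_comm [Group G] [CommSemiring k] (x y : k[G]) :
    (x * y).coeff 1 = (y * x).coeff 1 := by
  classical
  induction x using MonoidAlgebra.induction_linear with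
  | zero => rw [zero_mul, mul_zero]
  | add x x' hx hx' => simp only [add_mul, mul_add, MonoidAlgebra.coeff_add, Finsupp.add_apply, *]
  | single g r =>
    rw [MonoidAlgebra.coeff_single_mul_apply, MonoidAlgebra.coeff_mul_single_apply, mul_comm,
      mul_one, one_mul]

theorem single_eq_smul_single_one [Semiring k] (g : G) (r : k) :
    (single g r : k[G]) = r • single g 1 := by
  rw [MonoidAlgebra.smul_single, smul_eq_mul, mul_one]

variable [Group G]

section Twist

variable [CommSemiring k]

/-- The endomorphism `g ↦ χ(g) g` of the group algebra; restriction of scalars along it is the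
tensor product with the character `χ`. -/
def twist (χ : G →* k) : k[G] →ₐ[k] k[G] :=
  MonoidAlgebra.lift k k[G] G
    { toFun := fun g => single g (χ g)
      map_one' := by rw [map_one, MonoidAlgebra.one_def]
      map_mul' := fun g h => by rw [single_mul_single, map_mul] }

theorem twist_single (χ : G →* k) (g : G) (r : k) : twist χ (single g r) = single g (r * χ g) := by
  rw [twist, MonoidAlgebra.lift_single, MonoidHom.coe_mk, OneHom.coe_mk,
    MonoidAlgebra.smul_single, smul_eq_mul]

theorem coeff_twist (χ : G →* k) (x : k[G]) (g : G) :
    (twist χ x).coeff g = x.coeff g * χ g := by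
  classical
  induction x using MonoidAlgebra.induction_linear with
  | zero => simp only [map_zero, MonoidAlgebra.coeff_zero, Finsupp.zero_apply, zero_mul]
  | add x y hx hy =>
    simp only [map_add, MonoidAlgebra.coeff_add, Finsupp.add_apply, hx, hy, add_mul]
  | single h r => by_cases hg : h = g <;> simp [twist_single, hg]

theorem twist_twist (χ ψ : G →* k) (x : k[G]) : twist χ (twist ψ x) = twist (ψ * χ) x := by
  ext g
  simp only [coeff_twist, MonoidHom.mul_apply, mul_assoc]

theorem twist_one (x : k[G]) : twist 1 x = x := by
  ext g
  rw [coeff_twist, MonoidHom.one_apply, mul_one]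

end Twist

variable [Fintype G]

/-- The sum of the elements of the subgroup `H`, weighted by the character `χ`: a multiple of the
projection onto the `χ⁻¹`-isotypic part for `H`. It covers both the row sums (`χ = 1`) and the
signed column sums (`χ` the sign) of tableaux. -/
def charSum [CommSemiring k] (χ : G →* k) (H : Subgroup G) : k[G] :=
  open Classical in ∑ g with g ∈ H, single g (χ g)

section CommSemiring

variable [CommSemiring k] {χ ψ : G →* k} {H K : Subgroup G} {g : G}

open Classical in
theorem coeff_charSum (χ : G →* k) (H : Subgroup G) (g : G) :
    (charSum χ H).coeff g = if g ∈ H then χ g else 0 := by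
  rw [charSum, MonoidAlgebra.coeff_sum, Finsupp.finsetSum_apply]
  simp only [MonoidAlgebra.coeff_single, Finsupp.single_apply]
  rw [Finset.sum_ite_eq']
  simp only [Finset.mem_filter, Finset.mem_univ, true_and]

theorem single_mul_charSum (χ : G →* k) (hg : g ∈ H) :
    single g (χ g) * charSum χ H = charSum χ H := by
  classical
  ext x
  simp only [MonoidAlgebra.coeff_single_mul_apply, coeff_charSum, mul_ite, mul_zero, ← map_mul,
    mul_inv_cancel_left, H.mul_mem_cancel_left (H.inv_mem hg)]

theorem charSum_mul_single (χ : G →* k) (hg : g ∈ H) :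
    charSum χ H * single g (χ g) = charSum χ H := by
  classical
  ext x
  simp only [MonoidAlgebra.coeff_mul_single_apply, coeff_charSum, ite_mul, zero_mul, ← map_mul,
    inv_mul_cancel_right, H.mul_mem_cancel_right (H.inv_mem hg)]

theorem charSum_mul_self (χ : G →* k) (H : Subgroup G) :
    charSum χ H * charSum χ H = Nat.card H • charSum χ H := by
  classical
  nth_rewrite 1 [charSum]
  rw [Finset.sum_mul, Finset.sum_congr rfl fun g hg =>
    single_mul_charSum χ (Finset.mem_filter.1 hg).2, Finset.sum_const, Nat.card_eq_fintype_card,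
    Fintype.card_subtype]

theorem single_one_mul_charSum_comap_conj (χ : G →* k) (H : Subgroup G) (g : G) :
    single g 1 * charSum χ (H.comap (MulAut.conj g).toMonoidHom) = charSum χ H * single g 1 := by
  classical
  ext x
  have hχ : χ (g⁻¹ * x) = χ (x * g⁻¹) := by rw [map_mul, map_mul, mul_comm]
  simp only [MonoidAlgebra.coeff_single_mul_apply, MonoidAlgebra.coeff_mul_single_apply,
    coeff_charSum, one_mul, mul_one, hχ, Subgroup.mem_comap, MulEquiv.toMonoidHom_eq_coe,
    MonoidHom.coe_coe, MulAut.conj_apply, mul_inv_cancel_left]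

theorem coeff_one_charSum_mul_charSum (h : Disjoint K H) :
    (charSum ψ K * charSum χ H).coeff 1 = 1 := by
  classical
  rw [MonoidAlgebra.coeff_mul_apply_left, Finsupp.sum_fintype _ _ fun g => zero_mul _,
    Finset.sum_eq_single 1]
  · simp only [coeff_charSum, inv_one, mul_one, one_mem, if_true, map_one]
  · intro g _ hg
    rw [coeff_charSum, coeff_charSum, mul_one, H.inv_mem_iff, ite_zero_mul_ite_zero, if_neg]
    exact fun hgKH => hg (Subgroup.disjoint_def.1 h hgKH.1 hgKH.2)
  · exact fun h1 => absurd (Finset.mem_univ _) h1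

theorem charSum_mul_charSum_ne_zero [Nontrivial k] (h : Disjoint K H) :
    charSum ψ K * charSum χ H ≠ 0 := fun h0 => by
  have h1 := coeff_one_charSum_mul_charSum (ψ := ψ) (χ := χ) h
  rw [h0, MonoidAlgebra.coeff_zero, Finsupp.zero_apply] at h1
  exact zero_ne_one h1

theorem charSum_mul_charSum_mul_charSum_ne_zero (h : Disjoint K H) (hH : (Nat.card H : k) ≠ 0) :
    charSum χ H * charSum ψ K * charSum χ H ≠ 0 := fun h0 => hH <| by
  have h1 := coeff_one_mul_comm (charSum χ H) (charSum ψ K * charSum χ H)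
  rwa [← mul_assoc, h0, mul_assoc, charSum_mul_self, mul_smul_comm, MonoidAlgebra.coeff_smul_apply,
    coeff_one_charSum_mul_charSum h, MonoidAlgebra.coeff_zero, Finsupp.zero_apply,
    nsmul_one, eq_comm] at h1

theorem twist_charSum (χ ψ : G →* k) (H : Subgroup G) :
    twist χ (charSum ψ H) = charSum (ψ * χ) H := by
  simp only [charSum, map_sum, twist_single, MonoidHom.mul_apply]

theorem charSum_mul_single_mul_charSum_of_mul {q p : G} (hq : q ∈ K) (hp : p ∈ H) :
    charSum ψ K * single (q * p) 1 * charSum χ H =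
      (ψ q⁻¹ * χ p⁻¹) • (charSum ψ K * charSum χ H) := by
  have hqp : (single (q * p) 1 : k[G]) =
      (ψ q⁻¹ * χ p⁻¹) • (single q (ψ q) * single p (χ p)) := by
    rw [single_mul_single, MonoidAlgebra.smul_single, smul_eq_mul, mul_mul_mul_comm,
      ← map_mul, ← map_mul, inv_mul_cancel, inv_mul_cancel, map_one, map_one, one_mul]
  rw [hqp, mul_smul_comm, smul_mul_assoc, ← mul_assoc, charSum_mul_single ψ hq, mul_assoc,
    single_mul_charSum χ hp]

end CommSemiring

section IsDomain

variable [CommRing k] [IsDomain k] {χ ψ : G →* k} {H K : Subgroup G}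

theorem charSum_mul_single_mul_charSum_eq_zero {g x : G} (hxK : x ∈ K) (hxH : g⁻¹ * x * g ∈ H)
    (hx : ψ x ≠ χ x) : charSum ψ K * single g 1 * charSum χ H = 0 := by
  have hψ : charSum ψ K * single g 1 * charSum χ H =
      ψ x • (charSum ψ K * single (x * g) 1 * charSum χ H) := by
    nth_rewrite 1 [← charSum_mul_single ψ hxK]
    rw [mul_assoc (charSum ψ K), single_mul_single, mul_one, single_eq_smul_single_one,
      mul_smul_comm, smul_mul_assoc]
  have hχ : charSum ψ K * single g 1 * charSum χ H =
      χ x • (charSum ψ K * single (x * g) 1 * charSum χ H) := by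
    have hconj : χ (g⁻¹ * x * g) = χ x := by
      rw [map_mul, map_mul, mul_right_comm, ← map_mul, inv_mul_cancel, map_one, one_mul]
    nth_rewrite 1 [← single_mul_charSum χ hxH]
    rw [hconj, ← mul_assoc, mul_assoc (charSum ψ K) (single g 1), single_mul_single, one_mul,
      mul_assoc g⁻¹, mul_inv_cancel_left, single_eq_smul_single_one, mul_smul_comm, smul_mul_assoc]
  have h0 : (ψ x - χ x) • (charSum ψ K * single (x * g) 1 * charSum χ H) = 0 := by
    rw [sub_smul, ← hψ, ← hχ, sub_self]
  rw [hψ, (smul_eq_zero_iff_right (sub_ne_zero.2 hx)).1 h0, smul_zero]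

theorem charSum_mul_mul_charSum_eq_zero (h : ∀ g, ∃ x ∈ K, g⁻¹ * x * g ∈ H ∧ ψ x ≠ χ x)
    (a : k[G]) : charSum ψ K * a * charSum χ H = 0 := by
  induction a using MonoidAlgebra.induction_linear with
  | zero => rw [mul_zero, zero_mul]
  | add a b ha hb => rw [mul_add, add_mul, ha, hb, add_zero]
  | single g r =>
    obtain ⟨x, hxK, hxH, hx⟩ := h g
    rw [single_eq_smul_single_one, mul_smul_comm, smul_mul_assoc,
      charSum_mul_single_mul_charSum_eq_zero hxK hxH hx, smul_zero]

theorem exists_charSum_mul_mul_charSum_eq_smul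
    (h : ∀ g, (∃ q ∈ K, ∃ p ∈ H, g = q * p) ∨ ∃ x ∈ K, g⁻¹ * x * g ∈ H ∧ ψ x ≠ χ x) (a : k[G]) :
    ∃ r : k, charSum ψ K * a * charSum χ H = r • (charSum ψ K * charSum χ H) := by
  induction a using MonoidAlgebra.induction_linear with
  | zero => exact ⟨0, by rw [mul_zero, zero_mul, zero_smul]⟩
  | add a b ha hb =>
    obtain ⟨r, hr⟩ := ha
    obtain ⟨s, hs⟩ := hb
    exact ⟨r + s, by rw [mul_add, add_mul, hr, hs, add_smul]⟩
  | single g r =>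
    rw [single_eq_smul_single_one, mul_smul_comm, smul_mul_assoc]
    obtain ⟨q, hq, p, hp, rfl⟩ | ⟨x, hxK, hxH, hx⟩ := h g
    · exact ⟨_, by rw [charSum_mul_single_mul_charSum_of_mul hq hp, smul_smul]⟩
    · exact ⟨0, by rw [charSum_mul_single_mul_charSum_eq_zero hxK hxH hx, smul_zero, zero_smul]⟩

end IsDomain

end GroupAlgebra

section SimpleModules

theorem exists_mul_mul_self_eq {R : Type*} [Ring R] [IsSemisimpleRing R] (u : R) :
    ∃ y, u * y * u = u := by
  obtain ⟨e, he, h⟩ := IsSemisimpleRing.ideal_eq_span_idempotent (Ideal.span {u})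
  obtain ⟨y, hy⟩ := Ideal.mem_span_singleton'.1 (h.ge (Ideal.mem_span_singleton_self e))
  obtain ⟨z, hz⟩ := Ideal.mem_span_singleton'.1 (h.le (Ideal.mem_span_singleton_self u))
  exact ⟨y, by rw [mul_assoc, hy, ← hz, mul_assoc, he.eq]⟩

theorem isSimpleModule_span_singleton {k A : Type*} [Field k] [Ring A] [Algebra k A]
    [IsSemisimpleRing A] {e : A} (he : e ≠ 0) (h : ∀ a, ∃ r : k, e * a * e = r • e) :
    IsSimpleModule A (Submodule.span A {e}) := by
  have he_mem := Submodule.mem_span_singleton_self (R := A) e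
  refine isSimpleModule_iff_toSpanSingleton_surjective.2
    ⟨⟨⟨e, he_mem⟩, 0, fun h0 => he (congrArg Subtype.val h0)⟩, ?_⟩
  rintro ⟨u, hu⟩ hu0 ⟨v, hv⟩
  obtain ⟨x, rfl⟩ := Submodule.mem_span_singleton.1 hu
  obtain ⟨z, rfl⟩ := Submodule.mem_span_singleton.1 hv
  obtain ⟨y, hy⟩ := exists_mul_mul_self_eq (x • e)
  obtain ⟨r, hr⟩ := h (y * x)
  have hyu : e * (y * (x • e)) = r • e := by rw [← hr, smul_eq_mul, mul_assoc, mul_assoc]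
  have hr0 : r ≠ 0 := fun hr0 => hu0 <| Subtype.ext <| calc
    x • e = x * (e * (y * (x • e))) := by rw [← mul_assoc, ← mul_assoc, ← smul_eq_mul x e, hy]
    _ = 0 := by rw [hyu, hr0, zero_smul, mul_zero]
  refine ⟨z * (r⁻¹ • e) * y, Subtype.ext ?_⟩
  change z * (r⁻¹ • e) * y * (x • e) = z * e
  rw [mul_assoc, mul_assoc, smul_mul_assoc, hyu, smul_smul, inv_mul_cancel₀ hr0, one_smul]

section Ring

variable {A M N : Type*} [Ring A] [AddCommGroup M] [Module A M] [AddCommGroup N] [Module A N]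

theorem not_isSimpleModule_prod [Nontrivial M] [Nontrivial N] : ¬ IsSimpleModule A (M × N) := by
  intro _
  rcases LinearMap.injective_or_eq_zero (LinearMap.fst A M N) with h | h
  · obtain ⟨y, hy⟩ := exists_ne (0 : N)
    exact hy (congrArg Prod.snd (@h ((0 : M), y) 0 rfl))
  · obtain ⟨x, hx⟩ := exists_ne (0 : M)
    exact hx (LinearMap.congr_fun h (x, 0))

theorem linearMap_eq_zero_of_isEmpty_linearEquiv [IsSimpleModule A M] [IsSimpleModule A N]
    (h : IsEmpty (M ≃ₗ[A] N)) (f : M →ₗ[A] N) : f = 0 :=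
  (LinearMap.bijective_or_eq_zero f).resolve_left fun hf => h.elim (.ofBijective f hf)

/-- The reason is Goursat's lemma: a proper submodule with nonzero projections to both factors would
be the graph of an isomorphism. -/
theorem eq_top_of_mem_of_isEmpty_linearEquiv [IsSimpleModule A M] [IsSimpleModule A N]
    (h : IsEmpty (M ≃ₗ[A] N)) {U : Submodule A (M × N)} {w : M × N} (hw : w ∈ U) (hw₁ : w.1 ≠ 0)
    (hw₂ : w.2 ≠ 0) : U = ⊤ := by
  let p : U →ₗ[A] M := LinearMap.fst A M N ∘ₗ U.subtype
  have hp : Function.Surjective p := LinearMap.surjective_of_ne_zero fun hp =>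
    hw₁ (LinearMap.congr_fun hp ⟨w, hw⟩)
  rcases eq_bot_or_eq_top (U.comap (LinearMap.inr A M N)) with hU | hU
  · have hp' : Function.Injective p := by
      refine (injective_iff_map_eq_zero p).2 ?_
      rintro ⟨⟨x, y⟩, hxy⟩ (rfl : x = 0)
      have hy : y ∈ U.comap (LinearMap.inr A M N) := hxy
      rw [hU, Submodule.mem_bot] at hy
      exact Subtype.ext (Prod.ext rfl hy)
    let e := LinearEquiv.ofBijective p ⟨hp', hp⟩
    have h0 := linearMap_eq_zero_of_isEmpty_linearEquiv h
      (LinearMap.snd A M N ∘ₗ U.subtype ∘ₗ e.symm.toLinearMap)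
    refine absurd ?_ hw₂
    calc w.2 = (e.symm (e ⟨w, hw⟩) : M × N).2 := by rw [e.symm_apply_apply]
      _ = 0 := LinearMap.congr_fun h0 (e ⟨w, hw⟩)
  · refine eq_top_iff.2 fun ⟨x, y⟩ _ => ?_
    obtain ⟨⟨⟨x, y'⟩, hU'⟩, rfl⟩ := hp x
    have hy : (0, y - y') ∈ U := hU.ge (Submodule.mem_top (x := y - y'))
    have hadd := U.add_mem hU' hy
    rwa [Prod.mk_add_mk, add_zero, add_sub_cancel] at hadd

end Ring

section Algebra

variable {k A ι : Type*} [Field k] [Ring A] [Algebra k A] (S : ι → Type*)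
  [∀ i, AddCommGroup (S i)] [∀ i, Module k (S i)] [∀ i, Module A (S i)]
  [∀ i, IsScalarTower k A (S i)]

/-- The action of an algebra on a family of modules. -/
def actionHom : A →ₐ[k] ∀ i, Module.End k (S i) :=
  AlgHom.pi fun i => Algebra.lsmul k k (S i)

variable {S} [IsAlgClosed k] [∀ i, IsSimpleModule A (S i)] [∀ i, FiniteDimensional k (S i)]
  [Finite ι]

theorem exists_end_pi_apply_eq_smul (hS : Pairwise fun i j => IsEmpty (S i ≃ₗ[A] S j))
    (θ : Module.End A (∀ i, S i)) (i : ι) : ∃ r : k, ∀ v, θ v i = r • v i := by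
  classical
  have := Fintype.ofFinite ι
  obtain ⟨r, hr⟩ := (IsSimpleModule.algebraMap_end_bijective_of_isAlgClosed k).2
    (LinearMap.proj i ∘ₗ θ ∘ₗ LinearMap.single A S i)
  refine ⟨r, fun v => ?_⟩
  conv_lhs => rw [← Finset.univ_sum_single v, map_sum, Finset.sum_apply]
  rw [Finset.sum_eq_single i _ fun hi => absurd (Finset.mem_univ i) hi]
  · exact (LinearMap.congr_fun hr (v i)).symm
  · intro j _ hj
    exact LinearMap.congr_fun (linearMap_eq_zero_of_isEmpty_linearEquiv (hS hj)
      (LinearMap.proj i ∘ₗ θ ∘ₗ LinearMap.single A S j)) (v j)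

theorem actionHom_surjective (hS : Pairwise fun i j => IsEmpty (S i ≃ₗ[A] S j)) :
    Function.Surjective (actionHom (k := k) (A := A) S) := by
  classical
  intro f
  have := Module.Finite.of_restrictScalars_finite k (Module.End A (∀ i, S i)) (∀ i, S i)
  let F : Module.End (Module.End A (∀ i, S i)) (∀ i, S i) :=
    { toFun := fun v i => f i (v i)
      map_add' := fun v w => funext fun i => map_add (f i) (v i) (w i)
      map_smul' := fun θ v => funext fun i => by
        obtain ⟨r, hr⟩ := exists_end_pi_apply_eq_smul (k := k) hS θ i
        rw [Module.End.smul_def, hr, map_smul, RingHom.id_apply, Module.End.smul_def, hr] }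
  obtain ⟨a, ha⟩ := Module.Finite.toModuleEnd_moduleEnd_surjective F
  refine ⟨a, funext fun i => LinearMap.ext fun v => ?_⟩
  have h := congrFun (LinearMap.congr_fun ha (Pi.single i v)) i
  change (a • Pi.single i v : ∀ i, S i) i = f i (Pi.single (M := S) i v i) at h
  rwa [Pi.smul_apply, Pi.single_eq_same] at h

end Algebra

section Group

open MonoidAlgebra (single single_mul_single)
open scoped MonoidAlgebra

section ConjSum

variable {k G : Type*} [CommSemiring k] [Group G] [Fintype G]

/-- The sum of the conjugates of an element of a group algebra; up to the factor `|G|` it projects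
onto the center. -/
def conjSum (x : k[G]) : k[G] := ∑ g, single g 1 * x * single g⁻¹ 1

theorem coeff_one_conjSum (x : k[G]) : (conjSum x).coeff 1 = Nat.card G * x.coeff 1 := by
  have h (g : G) : (single g 1 * x * single g⁻¹ 1).coeff 1 = x.coeff 1 := by
    rw [MonoidAlgebra.coeff_mul_single_apply, MonoidAlgebra.coeff_single_mul_apply]
    simp only [inv_inv, one_mul, mul_one, inv_mul_cancel]
  rw [conjSum, MonoidAlgebra.coeff_sum, Finsupp.finsetSum_apply, Finset.sum_congr rfl
    fun g _ => h g, Finset.sum_const, Finset.card_univ, nsmul_eq_mul, Nat.card_eq_fintype_card]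

theorem conjSum_mem_center (x : k[G]) : conjSum x ∈ Subalgebra.center k k[G] := by
  have h (g : G) : single g 1 * conjSum x = conjSum x * single g 1 := by
    rw [conjSum, Finset.mul_sum, Finset.sum_mul]
    refine Fintype.sum_equiv (Equiv.mulLeft g) _ _ fun i => ?_
    rw [Equiv.coe_mulLeft, mul_inv_rev, mul_assoc _ (single (i⁻¹ * g⁻¹) 1), single_mul_single,
      inv_mul_cancel_right, ← mul_assoc, ← mul_assoc, single_mul_single, mul_one]
  refine Subalgebra.mem_center_iff.2 fun y => ?_
  induction y using MonoidAlgebra.induction_linear with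
  | zero => rw [zero_mul, mul_zero]
  | add x y hx hy => rw [mul_add, add_mul, hx, hy]
  | single g r => rw [single_eq_smul_single_one, smul_mul_assoc, mul_smul_comm, h]

theorem conjSum_smul_eq {V : Type*} [AddCommMonoid V] [Module k V] [Module k[G] V]
    [IsScalarTower k k[G] V] {x : k[G]} {r : k} (hx : ∀ v : V, x • v = r • v) (v : V) :
    conjSum x • v = (Nat.card G * r) • v := by
  have h (g : G) : (single g 1 * x * single g⁻¹ 1) • v = r • v := by
    rw [mul_smul, mul_smul, hx, smul_comm, smul_smul, single_mul_single, mul_inv_cancel, mul_one,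
      ← MonoidAlgebra.one_def, one_smul]
  rw [conjSum, Finset.sum_smul, Finset.sum_congr rfl fun g _ => h g, Finset.sum_const,
    Finset.card_univ, ← Nat.card_eq_fintype_card, ← Nat.cast_smul_eq_nsmul k, smul_smul]

end ConjSum

theorem finrank_center_le_card_conjClasses (k G : Type*) [Field k] [Group G] [Finite G] :
    Module.finrank k (Subalgebra.center k k[G]) ≤ Nat.card (ConjClasses G) := by
  have := Fintype.ofFinite (ConjClasses G)
  let Φ : Subalgebra.center k k[G] →ₗ[k] ConjClasses G → k :=
    LinearMap.pi fun c => Finsupp.lapply c.out ∘ₗ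
      (MonoidAlgebra.coeffLinearEquiv k).toLinearMap ∘ₗ (Subalgebra.center k k[G]).val.toLinearMap
  have hΦ : Function.Injective Φ := by
    refine (injective_iff_map_eq_zero Φ).2 fun z hz =>
      Subtype.ext (MonoidAlgebra.ext (Finsupp.ext fun g => ?_))
    obtain ⟨x, hx⟩ := isConj_iff.1 (ConjClasses.mk_eq_mk_iff_isConj.1
      (Quotient.out_eq (ConjClasses.mk g)))
    have hcomm := congrArg (fun y : k[G] => y.coeff (g * x))
      (Subalgebra.mem_center_iff.1 z.2 (single x 1))
    simp only [MonoidAlgebra.coeff_single_mul_apply, MonoidAlgebra.coeff_mul_single_apply, one_mul,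
      mul_one, mul_inv_cancel_right] at hcomm
    have hz' : z.1.coeff (ConjClasses.mk g).out = 0 := congrFun hz (ConjClasses.mk g)
    rwa [← hx, inv_mul_cancel_right, inv_mul_cancel_left, hz', hx, eq_comm] at hcomm
  have h := LinearMap.finrank_le_finrank_of_injective hΦ
  rwa [Module.finrank_fintype_fun_eq_card, ← Nat.card_eq_fintype_card] at h

section Faithful

variable {k G ι : Type*} [Field k] [Group G] [Finite G] {S : ι → Type*} [∀ i, AddCommGroup (S i)]
  [∀ i, Module k (S i)] [∀ i, Module k[G] (S i)] [∀ i, IsScalarTower k k[G] (S i)]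

theorem exists_mem_center_smul_eq (hG : (Nat.card G : k) ≠ 0)
    (hS : Function.Surjective (actionHom (k := k) (A := k[G]) S)) (c : ι → k) :
    ∃ z ∈ Subalgebra.center k k[G], ∀ i (v : S i), z • v = c i • v := by
  have := Fintype.ofFinite G
  obtain ⟨x, hx⟩ := hS fun i => ((Nat.card G : k)⁻¹ * c i) • 1
  refine ⟨conjSum x, conjSum_mem_center x, fun i v => ?_⟩
  rw [conjSum_smul_eq (r := (Nat.card G : k)⁻¹ * c i) fun v =>
    LinearMap.congr_fun (congrFun hx i) v, mul_inv_cancel_left₀ hG]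

variable [Finite ι]

theorem eq_zero_of_mem_center_of_actionHom_eq_zero [∀ i, Nontrivial (S i)]
    [∀ i, FiniteDimensional k (S i)] (hι : Nat.card (ConjClasses G) ≤ Nat.card ι)
    (hG : (Nat.card G : k) ≠ 0) (hS : Function.Surjective (actionHom (k := k) (A := k[G]) S))
    {z : k[G]} (hz : z ∈ Subalgebra.center k k[G]) (h0 : actionHom (k := k) S z = 0) : z = 0 := by
  have := Fintype.ofFinite ι
  let Z := Subalgebra.toSubmodule (Subalgebra.center k k[G])
  let Ψ : Z →ₗ[k] ∀ i, Module.End k (S i) := (actionHom S).toLinearMap ∘ₗ Z.subtype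
  let D : (ι → k) →ₗ[k] ∀ i, Module.End k (S i) :=
    LinearMap.pi fun i => LinearMap.toSpanSingleton k _ 1 ∘ₗ LinearMap.proj i
  have hD : Function.Injective D := fun c d hcd => funext fun i =>
    smul_left_injective k (one_ne_zero (α := Module.End k (S i))) (congrFun hcd i)
  have hDΨ : LinearMap.range D ≤ LinearMap.range Ψ := by
    rintro _ ⟨c, rfl⟩
    obtain ⟨x, hx, hxc⟩ := exists_mem_center_smul_eq hG hS c
    exact ⟨⟨x, hx⟩, funext fun i => LinearMap.ext (hxc i)⟩
  have hrank : Module.finrank k Z ≤ Module.finrank k (LinearMap.range Ψ) := calc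
    Module.finrank k Z ≤ Nat.card ι := (finrank_center_le_card_conjClasses k G).trans hι
    _ = Module.finrank k (LinearMap.range D) := by
      rw [LinearMap.finrank_range_of_inj hD, Module.finrank_fintype_fun_eq_card,
        Nat.card_eq_fintype_card]
    _ ≤ Module.finrank k (LinearMap.range Ψ) := Submodule.finrank_mono hDΨ
  have hker : LinearMap.ker Ψ = ⊥ := by
    rw [← Submodule.finrank_eq_zero (R := k)]
    have := LinearMap.finrank_range_add_finrank_ker Ψ
    lia
  exact congrArg Subtype.val (LinearMap.ker_eq_bot'.1 hker ⟨z, hz⟩ h0)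

/-- Averaging over conjugation reduces injectivity to the center, which acts on `∏ i, S i` through
all `|ι|`-tuples of scalars while its dimension is at most the number of conjugacy classes. -/
theorem actionHom_bijective [IsAlgClosed k] [∀ i, IsSimpleModule k[G] (S i)]
    [∀ i, FiniteDimensional k (S i)] (hS : Pairwise fun i j => IsEmpty (S i ≃ₗ[k[G]] S j))
    (hι : Nat.card (ConjClasses G) ≤ Nat.card ι) (hG : (Nat.card G : k) ≠ 0) :
    Function.Bijective (actionHom (k := k) (A := k[G]) S) := by
  have := Fintype.ofFinite G
  have (i : ι) : Nontrivial (S i) := IsSimpleModule.nontrivial k[G] (S i)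
  have hsurj := actionHom_surjective (k := k) hS
  refine ⟨(injective_iff_map_eq_zero _).2 fun a ha => MonoidAlgebra.ext (Finsupp.ext fun g => ?_),
    hsurj⟩
  have hzero : conjSum (single g⁻¹ 1 * a) = 0 := by
    refine eq_zero_of_mem_center_of_actionHom_eq_zero hι hG hsurj (conjSum_mem_center _) ?_
    simp only [conjSum, map_sum, map_mul, ha, mul_zero, zero_mul, Finset.sum_const_zero]
  have hcoeff := coeff_one_conjSum (single g⁻¹ 1 * a)
  rw [hzero, MonoidAlgebra.coeff_single_mul_apply, inv_inv, mul_one, one_mul] at hcoeff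
  exact (mul_eq_zero.1 hcoeff.symm).resolve_left hG

end Faithful

end Group

end SimpleModules

section YoungSubgroups

variable {α β γ : Type*}

/-- The Young subgroup of the permutations that preserve the fibers of `f`. The row group and the
column group of a tableau have this form. -/
def youngSubgroup (f : α → β) : Subgroup (Equiv.Perm α) where
  carrier := {σ | ∀ k, f (σ k) = f k}
  one_mem' _ := rfl
  mul_mem' hσ hτ k := (hσ _).trans (hτ k)
  inv_mem' {σ} hσ k := (hσ _).symm.trans (congrArg f (σ.apply_symm_apply k))

theorem swap_mem_youngSubgroup [DecidableEq α] {f : α → β} {i j : α} (h : f i = f j) :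
    Equiv.swap i j ∈ youngSubgroup f := fun k => by
  rw [Equiv.swap_apply_def]
  split_ifs with hi hj
  · rw [hi, h]
  · rw [hj, h]
  · rfl

theorem youngSubgroup_comp_perm (f : α → β) (g : Equiv.Perm α) :
    youngSubgroup (f ∘ g) = (youngSubgroup f).comap (MulAut.conj g).toMonoidHom := by
  ext σ
  refine g.forall_congr fun k => ?_
  simp only [Function.comp_apply, MulEquiv.toMonoidHom_eq_coe, MonoidHom.coe_coe,
    MulAut.conj_apply, Equiv.Perm.mul_apply, Equiv.Perm.inv_def, Equiv.symm_apply_apply]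

theorem disjoint_youngSubgroup {f : α → β} {g : α → γ}
    (h : Function.Injective fun k => (f k, g k)) :
    Disjoint (youngSubgroup f) (youngSubgroup g) :=
  Subgroup.disjoint_def.2 fun hf hg => Equiv.ext fun k => h (Prod.ext (hf k) (hg k))

theorem exists_swap_mem_youngSubgroup [DecidableEq α] {f : α → β} {g : α → γ} {σ : Equiv.Perm α}
    (h : ¬ Function.Injective fun k => (g (σ⁻¹ k), f k)) :
    ∃ i j, i ≠ j ∧ Equiv.swap i j ∈ youngSubgroup f ∧
      σ⁻¹ * Equiv.swap i j * σ ∈ youngSubgroup g := by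
  obtain ⟨i, j, hij, hne⟩ := Function.not_injective_iff.1 h
  refine ⟨i, j, hne, swap_mem_youngSubgroup (congrArg Prod.snd hij), ?_⟩
  rw [mul_assoc, Equiv.swap_mul_eq_mul_swap, inv_mul_cancel_left]
  exact swap_mem_youngSubgroup (congrArg Prod.fst hij)

end YoungSubgroups

section Diagrams

theorem snd_lt_rowLen_zero {μ : YoungDiagram} {c : ℕ × ℕ} (hc : c ∈ μ.cells) :
    c.2 < μ.rowLen 0 :=
  YoungDiagram.mem_iff_lt_rowLen.1 (μ.up_left_mem c.1.zero_le le_rfl hc)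

/-- The number of boxes in the first `i` rows. The dominance order compares these numbers. -/
def headCard (μ : YoungDiagram) (i : ℕ) : ℕ := (μ.cells.filter fun c => c.1 < i).card

theorem headCard_succ (μ : YoungDiagram) (i : ℕ) :
    headCard μ (i + 1) = headCard μ i + μ.rowLen i := by
  have h : Disjoint (μ.cells.filter fun c => c.1 < i) (μ.row i) :=
    Finset.disjoint_filter.2 fun c _ hlt heq => hlt.ne heq
  rw [headCard, headCard, YoungDiagram.rowLen_eq_card, ← Finset.card_union_of_disjoint h,
    YoungDiagram.row, ← Finset.filter_or]
  simp only [Nat.lt_succ_iff_lt_or_eq]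

theorem headCard_injective : Function.Injective headCard := by
  intro μ ν h
  have hrow (i : ℕ) : μ.rowLen i = ν.rowLen i := by
    have hsucc := congrFun h (i + 1)
    rwa [headCard_succ, headCard_succ, congrFun h i, add_right_inj] at hsucc
  refine YoungDiagram.ext (Finset.ext fun ⟨i, j⟩ => ?_)
  rw [YoungDiagram.mem_cells, YoungDiagram.mem_cells, YoungDiagram.mem_iff_lt_rowLen,
    YoungDiagram.mem_iff_lt_rowLen, hrow]

theorem card_filter_fst_lt_snd_eq (μ : YoungDiagram) (i j : ℕ) :
    (μ.cells.filter fun c => c.1 < i ∧ c.2 = j).card = min i (μ.colLen j) := by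
  have h : (μ.cells.filter fun c => c.1 < i ∧ c.2 = j) =
      Finset.range (min i (μ.colLen j)) ×ˢ {j} := by
    ext ⟨a, b⟩
    simp only [Finset.mem_filter, YoungDiagram.mem_cells, YoungDiagram.mem_iff_lt_colLen,
      Finset.mem_product, Finset.mem_range, Finset.mem_singleton, lt_min_iff]
    grind
  rw [h, Finset.card_product, Finset.card_range, Finset.card_singleton, mul_one]

theorem headCard_eq_sum (μ : YoungDiagram) (i : ℕ) :
    headCard μ i = ∑ j ∈ Finset.range (μ.rowLen 0), min i (μ.colLen j) := by
  rw [headCard, Finset.card_eq_sum_card_fiberwise (f := Prod.snd)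
    (t := Finset.range (μ.rowLen 0)) fun c hc =>
      Finset.mem_range.2 (snd_lt_rowLen_zero (Finset.mem_filter.1 hc).1)]
  refine Finset.sum_congr rfl fun j _ => ?_
  rw [Finset.filter_filter, card_filter_fst_lt_snd_eq]

end Diagrams

section Tableaux

variable {n : ℕ} {l m : Ptn n}

theorem card_filter_tableau (t : Tableau l) (p : ℕ × ℕ → Prop) [DecidablePred p] :
    (Finset.univ.filter fun k => p (t k).1).card = (l.1.cells.filter p).card := by
  refine Finset.card_bij (fun k _ => (t k).1) (fun k hk => ?_) (fun a _ b _ h => ?_) fun c hc => ?_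
  · exact Finset.mem_filter.2 ⟨(t k).2, (Finset.mem_filter.1 hk).2⟩
  · exact t.injective (Subtype.ext h)
  · obtain ⟨hc, hpc⟩ := Finset.mem_filter.1 hc
    exact ⟨t.symm ⟨c, hc⟩, by simpa using hpc, by rw [Equiv.apply_symm_apply]⟩

/-- The position of an entry according to its row in `s` and its column in `t`. -/
def crossPosition (t : Tableau l) (s : Tableau m) (k : Fin n) : ℕ × ℕ := ((s k).1.1, (t k).1.2)

theorem headCard_eq_sum_crossPosition (t : Tableau l) (s : Tableau m) (i : ℕ) :
    headCard m.1 i = ∑ j ∈ Finset.range (l.1.rowLen 0), (Finset.univ.filter fun k =>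
      (crossPosition t s k).1 < i ∧ (crossPosition t s k).2 = j).card := by
  rw [headCard, ← card_filter_tableau s, Finset.card_eq_sum_card_fiberwise
    (f := fun k => (t k).1.2) (t := Finset.range (l.1.rowLen 0)) fun k _ =>
      Finset.mem_range.2 (snd_lt_rowLen_zero (t k).2)]
  refine Finset.sum_congr rfl fun j _ => ?_
  rw [Finset.filter_filter]
  rfl

section Injective

variable {t : Tableau l} {s : Tableau m} (h : Function.Injective (crossPosition t s))
include h

theorem card_filter_crossPosition_le (i j : ℕ) :
    (Finset.univ.filter fun k => (crossPosition t s k).1 < i ∧ (crossPosition t s k).2 = j).card ≤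
      min i (l.1.colLen j) := by
  refine le_min ?_ ?_
  · conv_rhs => rw [← Finset.card_range i]
    refine Finset.card_le_card_of_injOn (fun k => (crossPosition t s k).1) (fun k hk => ?_)
      fun a ha b hb hab => h (Prod.ext hab ?_)
    · exact Finset.mem_range.2 (Finset.mem_filter.1 hk).2.1
    · exact (Finset.mem_filter.1 ha).2.2.trans (Finset.mem_filter.1 hb).2.2.symm
  · rw [YoungDiagram.colLen_eq_card, YoungDiagram.col, ← card_filter_tableau t]
    exact Finset.card_le_card (Finset.monotone_filter_right _ fun k _ hk => hk.2)

theorem headCard_le_of_crossPosition_injective (i : ℕ) : headCard m.1 i ≤ headCard l.1 i := by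
  rw [headCard_eq_sum_crossPosition t s, headCard_eq_sum]
  exact Finset.sum_le_sum fun j _ => card_filter_crossPosition_le h i j

end Injective

/-- Equal shapes force equality in all the estimates `card_filter_crossPosition_le`, so an entry in
column `j` of `t` lies in one of the first `l.colLen j` rows of `s`. -/
theorem crossPosition_mem_cells {t s : Tableau l} (h : Function.Injective (crossPosition t s))
    (k : Fin n) : crossPosition t s k ∈ l.1.cells := by
  obtain ⟨i, j, hk⟩ : ∃ i j, crossPosition t s k = (i, j) := ⟨_, _, rfl⟩
  have hj : j < l.1.rowLen 0 := by
    rw [show j = (t k).1.2 from (congrArg Prod.snd hk).symm]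
    exact snd_lt_rowLen_zero (t k).2
  have hcard (i' : ℕ) : (Finset.univ.filter fun k' =>
      (crossPosition t s k').1 < i' ∧ (crossPosition t s k').2 = j).card =
        min i' (l.1.colLen j) :=
    (Finset.sum_eq_sum_iff_of_le fun j _ => card_filter_crossPosition_le h i' j).1
      ((headCard_eq_sum_crossPosition t s i').symm.trans (headCard_eq_sum l.1 i')) j
      (Finset.mem_range.2 hj)
  have hlt : min i (l.1.colLen j) < min (i + 1) (l.1.colLen j) := by
    rw [← hcard, ← hcard]
    refine Finset.card_lt_card ((Finset.ssubset_iff_of_subset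
      (Finset.monotone_filter_right _ fun k' _ hk' => ⟨hk'.1.trans i.lt_succ_self, hk'.2⟩)).2
        ⟨k, ?_, ?_⟩)
    · simp [hk]
    · simp [hk]
  rw [hk, YoungDiagram.mem_cells, YoungDiagram.mem_iff_lt_colLen]
  lia

/-- The row group of a tableau. -/
def rowGroup (t : Tableau l) : Subgroup (Equiv.Perm (Fin n)) := youngSubgroup fun k => (t k).1.1

/-- The column group of a tableau. -/
def colGroup (t : Tableau l) : Subgroup (Equiv.Perm (Fin n)) := youngSubgroup fun k => (t k).1.2

theorem disjoint_colGroup_rowGroup (t : Tableau l) : Disjoint (colGroup t) (rowGroup t) :=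
  disjoint_youngSubgroup fun _ _ h => t.injective (Subtype.ext (Prod.swap_injective h))

theorem exists_swap_mem_colGroup {t : Tableau l} {s : Tableau m} {g : Equiv.Perm (Fin n)}
    (h : ¬ Function.Injective (crossPosition t (g⁻¹.trans s))) :
    ∃ i j, i ≠ j ∧ Equiv.swap i j ∈ colGroup t ∧ g⁻¹ * Equiv.swap i j * g ∈ rowGroup s :=
  exists_swap_mem_youngSubgroup (f := fun k => (t k).1.2) (g := fun k => (s k).1.1) h

theorem exists_mem_colGroup_mem_rowGroup_eq_mul {t : Tableau l} {g : Equiv.Perm (Fin n)}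
    (h : Function.Injective (crossPosition t (g⁻¹.trans t))) :
    ∃ q ∈ colGroup t, ∃ p ∈ rowGroup t, g = q * p := by
  let q : Equiv.Perm (Fin n) := .ofBijective
    (fun k => t.symm ⟨crossPosition t (g⁻¹.trans t) k, crossPosition_mem_cells h k⟩)
    (Finite.injective_iff_bijective.1 fun i j hij =>
      h (congrArg Subtype.val (t.symm.injective hij)))
  have hq (k : Fin n) : (t (q k)).1 = crossPosition t (g⁻¹.trans t) k :=
    congrArg Subtype.val (t.apply_symm_apply _)
  refine ⟨q⁻¹, (colGroup t).inv_mem fun k => (congrArg Prod.snd (hq k) :), q * g, fun k => ?_,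
    (inv_mul_cancel_left q g).symm⟩
  change (t (q (g k))).1.1 = _
  rw [hq, crossPosition, Equiv.trans_apply, Equiv.Perm.inv_def, Equiv.symm_apply_apply]

end Tableaux

section Partitions

theorem sum_rowLens (μ : YoungDiagram) : μ.rowLens.sum = μ.card := by
  rw [YoungDiagram.card, Finset.card_eq_sum_card_fiberwise (f := Prod.fst)
    (t := Finset.range (μ.colLen 0)) fun c hc => Finset.mem_range.2 <|
      YoungDiagram.mem_iff_lt_colLen.1 (μ.up_left_mem le_rfl c.2.zero_le hc)]
  change ∑ i ∈ Finset.range (μ.colLen 0), μ.rowLen i = _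
  exact Finset.sum_congr rfl fun i _ => μ.rowLen_eq_card

theorem sort_rowLens (μ : YoungDiagram) :
    (μ.rowLens : Multiset ℕ).sort (· ≥ ·) = μ.rowLens :=
  (Multiset.coe_eq_coe.1 (Multiset.sort_eq _ _)).eq_of_pairwise
    (fun _ _ _ _ h h' => le_antisymm h' h) (Multiset.pairwise_sort _ _) μ.rowLens_sorted.pairwise

theorem rowLens_ofRowLens_sort {n : ℕ} (p : n.Partition) :
    (YoungDiagram.ofRowLens (p.parts.sort (· ≥ ·)) (p.parts.pairwise_sort _).sortedGE).rowLens =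
      p.parts.sort (· ≥ ·) :=
  YoungDiagram.rowLens_ofRowLens_eq_self fun _ hx => p.parts_pos ((Multiset.mem_sort _).1 hx)

/-- A Young diagram with `n` boxes corresponds to the partition of `n` into its row lengths. -/
def ptnEquivPartition (n : ℕ) : Ptn n ≃ n.Partition where
  toFun l := ⟨l.1.rowLens, fun h => l.1.pos_of_mem_rowLens _ h, by
    rw [Multiset.sum_coe, sum_rowLens, l.2]⟩
  invFun p :=
    ⟨.ofRowLens (p.parts.sort (· ≥ ·)) (p.parts.pairwise_sort _).sortedGE, by
      rw [← sum_rowLens, rowLens_ofRowLens_sort, ← Multiset.sum_coe, Multiset.sort_eq,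
        p.parts_sum]⟩
  left_inv l := Subtype.ext <| by
    simp only [sort_rowLens]
    exact YoungDiagram.ofRowLens_to_rowLens_eq_self
  right_inv p := Nat.Partition.ext <| by
    simp only [rowLens_ofRowLens_sort, Multiset.sort_eq]

instance (n : ℕ) : Finite (Ptn n) := .of_equiv _ (ptnEquivPartition n).symm

theorem card_conjClasses_perm_le_card_ptn (n : ℕ) :
    Nat.card (ConjClasses (Equiv.Perm (Fin n))) ≤ Nat.card (Ptn n) := by
  have hinj : Function.Injective fun c : ConjClasses (Equiv.Perm (Fin n)) =>
      Quotient.liftOn c Equiv.Perm.partition fun _ _ => Equiv.Perm.partition_eq_of_isConj.1 := by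
    rintro ⟨σ⟩ ⟨τ⟩ h
    exact Quotient.sound (Equiv.Perm.partition_eq_of_isConj.2 h)
  rw [Nat.card_congr (ptnEquivPartition n)]
  convert Nat.card_le_card_of_injective _ hinj using 3
  exact (Fintype.card_fin n).symm

end Partitions

section SpechtModules

open MonoidAlgebra (single)

variable {n : ℕ} {l m : Ptn n}

/-- The sign character of `S_n`, with values in `ℂ`. -/
def signChar (n : ℕ) : Equiv.Perm (Fin n) →* ℂ :=
  (Int.castRingHom ℂ : ℤ →* ℂ).comp ((Units.coeHom ℤ).comp Equiv.Perm.sign)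

theorem signChar_apply (σ : Equiv.Perm (Fin n)) :
    signChar n σ = ((Equiv.Perm.sign σ : ℤ) : ℂ) := rfl

theorem signChar_swap {i j : Fin n} (h : i ≠ j) : signChar n (Equiv.swap i j) = -1 := by
  simp [signChar_apply, Equiv.Perm.sign_swap h]

theorem signChar_mul_signChar (n : ℕ) : signChar n * signChar n = 1 := by
  ext σ
  rcases Int.units_eq_one_or (Equiv.Perm.sign σ) with h | h <;> simp [signChar_apply, h]

theorem rowSum_eq_charSum (t : Tableau l) : rowSum t = charSum 1 (rowGroup t) := by
  refine Finset.sum_congr (Finset.ext fun σ => ?_) fun _ _ => rfl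
  simp only [Finset.mem_filter]
  rfl

theorem colSum_eq_charSum (t : Tableau l) : colSum t = charSum (signChar n) (colGroup t) := by
  refine Finset.sum_congr (Finset.ext fun σ => ?_) fun _ _ => rfl
  simp only [Finset.mem_filter]
  rfl

theorem colSum_mul_mul_rowSum_eq_zero (t : Tableau l) (s : Tableau m) {i : ℕ}
    (hi : headCard l.1 i < headCard m.1 i) (a : CS n) : colSum t * a * rowSum s = 0 := by
  rw [colSum_eq_charSum, rowSum_eq_charSum]
  refine charSum_mul_mul_charSum_eq_zero (fun g => ?_) a
  obtain ⟨i, j, hij, hcol, hrow⟩ := exists_swap_mem_colGroup (t := t) (s := s) (g := g) fun h =>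
    hi.not_ge (headCard_le_of_crossPosition_injective h i)
  refine ⟨_, hcol, hrow, ?_⟩
  rw [signChar_swap hij]
  norm_num

theorem exists_colSum_mul_mul_rowSum_eq_smul (t : Tableau l) (a : CS n) :
    ∃ r : ℂ, colSum t * a * rowSum t = r • (colSum t * rowSum t) := by
  rw [colSum_eq_charSum, rowSum_eq_charSum]
  refine exists_charSum_mul_mul_charSum_eq_smul (fun g => ?_) a
  by_cases h : Function.Injective (crossPosition t (g⁻¹.trans t))
  · exact Or.inl (exists_mem_colGroup_mem_rowGroup_eq_mul h)
  · obtain ⟨i, j, hij, hcol, hrow⟩ := exists_swap_mem_colGroup h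
    refine Or.inr ⟨_, hcol, hrow, ?_⟩
    rw [signChar_swap hij]
    norm_num

theorem colSum_mul_rowSum_ne_zero (t : Tableau l) : colSum t * rowSum t ≠ 0 := by
  rw [colSum_eq_charSum, rowSum_eq_charSum]
  exact charSum_mul_charSum_ne_zero (disjoint_colGroup_rowGroup t)

theorem mem_specht {t : Tableau l} {x : CS n} :
    x ∈ Specht t ↔ ∃ a, a * (colSum t * rowSum t) = x :=
  Submodule.mem_span_singleton

instance isSimpleModule_specht (t : Tableau l) : IsSimpleModule (CS n) (Specht t) := by
  refine isSimpleModule_span_singleton (k := ℂ) (colSum_mul_rowSum_ne_zero t) fun a => ?_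
  obtain ⟨r, hr⟩ := exists_colSum_mul_mul_rowSum_eq_smul t (rowSum t * a * colSum t)
  exact ⟨r, by rw [← hr]; noncomm_ring⟩

instance nontrivial_specht (t : Tableau l) : Nontrivial (Specht t) :=
  IsSimpleModule.nontrivial (CS n) _

theorem isEmpty_specht_linearEquiv_of_headCard_lt (t : Tableau l) (s : Tableau m) {i : ℕ}
    (hi : headCard l.1 i < headCard m.1 i) : IsEmpty (Specht t ≃ₗ[CS n] Specht s) := by
  refine ⟨fun f => ?_⟩
  let e : Specht t := ⟨colSum t * rowSum t, Submodule.mem_span_singleton_self _⟩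
  have hkill : colSum t • f e = 0 := Subtype.ext <| by
    obtain ⟨a, ha⟩ := mem_specht.1 (f e).2
    rw [Submodule.coe_smul, smul_eq_mul, ← ha, ← mul_assoc, ← mul_assoc, mul_assoc (colSum t),
      colSum_mul_mul_rowSum_eq_zero t s hi, ZeroMemClass.coe_zero]
  have hzero : colSum t * (colSum t * rowSum t) = 0 :=
    congrArg Subtype.val (f.injective (by rw [map_smul, hkill, map_zero] : f (colSum t • e) = f 0))
  have hscale : colSum t * (colSum t * rowSum t) =
      Nat.card (colGroup t) • (colSum t * rowSum t) := by
    rw [← mul_assoc, ← smul_mul_assoc, colSum_eq_charSum, charSum_mul_self]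
  rw [hscale] at hzero
  exact (smul_ne_zero Nat.card_pos.ne' (colSum_mul_rowSum_ne_zero t)) hzero

theorem isEmpty_specht_linearEquiv (t : Tableau l) (s : Tableau m) (h : l ≠ m) :
    IsEmpty (Specht t ≃ₗ[CS n] Specht s) := by
  obtain ⟨i, hi⟩ := Function.ne_iff.1 fun heq => h (Subtype.ext (headCard_injective heq))
  rcases hi.lt_or_gt with hlt | hgt
  · exact isEmpty_specht_linearEquiv_of_headCard_lt t s hlt
  · exact ⟨fun f => (isEmpty_specht_linearEquiv_of_headCard_lt s t hgt).false f.symm⟩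

end SpechtModules

section Associators

open MonoidAlgebra (single)

variable {n : ℕ} {l m : Ptn n}

theorem Ptn.conj_conj (l : Ptn n) : l.conj.conj = l :=
  Subtype.ext (YoungDiagram.transpose_transpose _)

/-- The transpose of a tableau. -/
def transposeTableau (t : Tableau l) : Tableau l.conj :=
  t.trans ((Equiv.prodComm ℕ ℕ).subtypeEquiv fun c => by
    rw [YoungDiagram.mem_cells, YoungDiagram.mem_cells]
    exact (YoungDiagram.mem_transpose (c := c.swap)).symm)

theorem twist_signChar_rowSum (t : Tableau l) :
    twist (signChar n) (rowSum t) = colSum (transposeTableau t) := by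
  rw [rowSum_eq_charSum, colSum_eq_charSum, twist_charSum, one_mul]
  rfl

theorem twist_signChar_colSum (t : Tableau l) :
    twist (signChar n) (colSum t) = rowSum (transposeTableau t) := by
  rw [rowSum_eq_charSum, colSum_eq_charSum, twist_charSum, signChar_mul_signChar]
  rfl

theorem twist_signChar_twist_signChar (x : CS n) :
    twist (signChar n) (twist (signChar n) x) = x := by
  rw [twist_twist, signChar_mul_signChar, twist_one]

theorem colGroup_trans (t : Tableau l) (g : Equiv.Perm (Fin n)) :
    colGroup (g.trans t) = (colGroup t).comap (MulAut.conj g).toMonoidHom :=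
  youngSubgroup_comp_perm (fun k => (t k).1.2) g

theorem single_mul_colSum_trans (t : Tableau l) (g : Equiv.Perm (Fin n)) :
    (single g 1 : CS n) * colSum (g.trans t) = colSum t * single g 1 := by
  rw [colSum_eq_charSum, colSum_eq_charSum, colGroup_trans, single_one_mul_charSum_comap_conj]

theorem rowGroup_trans (t : Tableau l) (g : Equiv.Perm (Fin n)) :
    rowGroup (g.trans t) = (rowGroup t).comap (MulAut.conj g).toMonoidHom :=
  youngSubgroup_comp_perm (fun k => (t k).1.1) g

theorem single_mul_rowSum_trans (t : Tableau l) (g : Equiv.Perm (Fin n)) :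
    (single g 1 : CS n) * rowSum (g.trans t) = rowSum t * single g 1 := by
  rw [rowSum_eq_charSum, rowSum_eq_charSum, rowGroup_trans, single_one_mul_charSum_comap_conj]

/-- The permutation of the entries that turns the tableau `t` into the tableau `s`. -/
def relabeling (t s : Tableau l) : Equiv.Perm (Fin n) := s.trans t.symm

theorem relabeling_trans (t s : Tableau l) : (relabeling t s).trans t = s := by
  rw [relabeling, Equiv.trans_assoc, Equiv.symm_trans_self, Equiv.trans_refl]

theorem single_relabeling_mul_symmetrizer (t s : Tableau l) :
    (single (relabeling t s) 1 : CS n) * (colSum s * rowSum s) =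
      colSum t * rowSum t * single (relabeling t s) 1 := by
  have hcol := single_mul_colSum_trans t (relabeling t s)
  have hrow := single_mul_rowSum_trans t (relabeling t s)
  rw [relabeling_trans] at hcol hrow
  rw [← mul_assoc, hcol, mul_assoc, hrow, mul_assoc]

/-- The map `x ↦ sgn(x) w` on the group algebra, where `sgn` is the sign twist and `w` is chosen
such that `S^l` is mapped to `S^{l'}`: it is the row sum of the transpose `t'` of the tableau `T l`
times the permutation that relabels `t'` to `T l'`. -/
def twistedMap (T : ∀ l : Ptn n, Tableau l) (l : Ptn n) : CS n →ₗ[ℂ] CS n :=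
  LinearMap.mulRight ℂ (rowSum (transposeTableau (T l)) *
      single (relabeling (transposeTableau (T l)) (T l.conj)) 1) ∘ₗ
    (twist (signChar n)).toLinearMap

variable (T : ∀ l : Ptn n, Tableau l)

theorem twistedMap_mul (l : Ptn n) (a x : CS n) :
    twistedMap T l (a * x) = twist (signChar n) a * twistedMap T l x := by
  simp [twistedMap, mul_assoc]

theorem twistedMap_symmetrizer (l : Ptn n) :
    twistedMap T l (colSum (T l) * rowSum (T l)) =
      rowSum (transposeTableau (T l)) *
        single (relabeling (transposeTableau (T l)) (T l.conj)) 1 *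
          (colSum (T l.conj) * rowSum (T l.conj)) := by
  rw [mul_assoc, single_relabeling_mul_symmetrizer]
  simp [twistedMap, twist_signChar_rowSum, twist_signChar_colSum, mul_assoc]

theorem twistedMap_mem {x : CS n} (hx : x ∈ Specht (T l)) :
    twistedMap T l x ∈ Specht (T l.conj) := by
  obtain ⟨a, rfl⟩ := mem_specht.1 hx
  rw [twistedMap_mul, twistedMap_symmetrizer, ← mul_assoc]
  exact mem_specht.2 ⟨_, rfl⟩

theorem twistedMap_symmetrizer_ne_zero (l : Ptn n) :
    twistedMap T l (colSum (T l) * rowSum (T l)) ≠ 0 := by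
  have hne : rowSum (transposeTableau (T l)) * colSum (transposeTableau (T l)) *
      rowSum (transposeTableau (T l)) ≠ 0 := by
    rw [rowSum_eq_charSum, colSum_eq_charSum]
    exact charSum_mul_charSum_mul_charSum_ne_zero (disjoint_colGroup_rowGroup _)
      (Nat.cast_ne_zero.2 Nat.card_pos.ne')
  have hunit (g : Equiv.Perm (Fin n)) : IsUnit (single g 1 : CS n) :=
    (Group.isUnit g).map (MonoidAlgebra.of ℂ (Equiv.Perm (Fin n)))
  simpa [twistedMap, twist_signChar_rowSum, twist_signChar_colSum, ← mul_assoc,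
    (hunit _).mul_left_eq_zero] using hne

theorem twistedMap_ne_zero {x : CS n} (hx : x ∈ Specht (T l)) (hx0 : x ≠ 0) :
    twistedMap T l x ≠ 0 := by
  have hxne : (⟨x, hx⟩ : Specht (T l)) ≠ 0 := fun h => hx0 (congrArg Subtype.val h)
  obtain ⟨a, ha⟩ := IsSimpleModule.toSpanSingleton_surjective (CS n) hxne
    ⟨_, Submodule.mem_span_singleton_self _⟩
  have ha' : a * x = colSum (T l) * rowSum (T l) := congrArg Subtype.val ha
  intro h
  refine twistedMap_symmetrizer_ne_zero T l ?_
  rw [← ha', twistedMap_mul, h, mul_zero]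

theorem exists_twistedMap_twistedMap_eq_smul (l : Ptn n) :
    ∃ r : ℂ, r ≠ 0 ∧ ∀ x ∈ Specht (T l), twistedMap T l.conj (twistedMap T l x) = r • x := by
  have hmem (x : Specht (T l)) : twistedMap T l.conj (twistedMap T l x) ∈ Specht (T l) :=
    (specht_congr l.conj_conj).le (twistedMap_mem T (twistedMap_mem T x.2))
  let F : Module.End (CS n) (Specht (T l)) :=
    { toFun x := ⟨_, hmem x⟩
      map_add' x y := Subtype.ext (by simp)
      map_smul' a x := Subtype.ext <| by
        simp [twistedMap_mul, twist_signChar_twist_signChar] }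
  obtain ⟨r, hr⟩ := (IsSimpleModule.algebraMap_end_bijective_of_isAlgClosed ℂ).2 F
  have hr' (x : CS n) (hx : x ∈ Specht (T l)) :
      twistedMap T l.conj (twistedMap T l x) = r • x :=
    (congrArg Subtype.val (LinearMap.congr_fun hr ⟨x, hx⟩)).symm
  obtain ⟨x, hx⟩ := exists_ne (0 : Specht (T l))
  have hx0 : (x : CS n) ≠ 0 := fun h => hx (Subtype.ext h)
  refine ⟨r, ?_, hr'⟩
  rintro rfl
  refine twistedMap_ne_zero T (twistedMap_mem T x.2) (twistedMap_ne_zero T x.2 hx0) ?_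
  rw [hr' x x.2, zero_smul]

/-- The scalars by which the two composites of the twisted maps act on `S^l` and on `S^{l'}` agree,
so dividing the maps by a square root of that scalar makes them mutually inverse. -/
theorem nonempty_associator : Nonempty (Associator T) := by
  choose r hr0 hr using exists_twistedMap_twistedMap_eq_smul T
  choose sqrt hsqrt using fun z : ℂ => IsAlgClosed.exists_eq_mul_self z
  have hrconj (l : Ptn n) : r l.conj = r l := by
    obtain ⟨x, hx⟩ := exists_ne (0 : Specht (T l))
    have hx0 := twistedMap_ne_zero T x.2 fun h => hx (Subtype.ext h)
    refine smul_left_injective ℂ hx0 ?_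
    simp only
    rw [← hr l.conj _ (twistedMap_mem T x.2), l.conj_conj, hr l x x.2, map_smul]
  let φ (l : Ptn n) : Specht (T l) →ₗ[ℂ] Specht (T l.conj) :=
    (sqrt (r l))⁻¹ • (twistedMap T l).restrict (p := (Specht (T l)).restrictScalars ℂ)
      (q := (Specht (T l.conj)).restrictScalars ℂ) fun _ => twistedMap_mem T
  have hφ (l : Ptn n) (v : Specht (T l)) :
      (φ l v : CS n) = (sqrt (r l))⁻¹ • twistedMap T l v := rfl
  refine ⟨φ, fun l σ v => Subtype.ext ?_, fun l v => ?_⟩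
  · rw [hφ, Submodule.coe_smul, smul_eq_mul, twistedMap_mul, twist_single, one_mul,
      single_eq_smul_single_one, signChar_apply, smul_mul_assoc, smul_comm,
      Submodule.coe_smul_of_tower, Submodule.coe_smul, hφ, smul_eq_mul, mul_smul_comm]
  · rw [hφ, hφ, map_smul, hr l v v.2, hrconj, smul_smul, smul_smul, ← mul_inv, ← hsqrt,
      inv_mul_cancel₀ (hr0 l), one_smul]

end Associators

section LieIsomorphisms

theorem map_proj {V W : Type*} [AddCommGroup V] [Module ℂ V] [Superspace V] [AddCommGroup W]
    [Module ℂ W] [Superspace W] (f : V →ₗ[ℂ] W)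
    (hf : ∀ i, ∀ v ∈ Superspace.part (V := V) i, f v ∈ Superspace.part (V := W) i)
    (i : ZMod 2) (v : V) : f (proj i v) = proj i (f v) := by
  have hv : v - proj i v ∈ Superspace.part (V := V) (i + 1) := by
    rw [proj, ← Submodule.projection_eq_self_sub_projection (isCompl_part i)]
    exact Submodule.projection_apply_mem _ _
  refine (proj_eq (hf i _ (proj_mem i v)) ?_).symm
  rw [← map_sub]
  exact hf _ _ hv

variable {ι κ A : Type*} {B B₁ : ι → Type*} {C C₁ : κ → Type*}
  [Ring A] [Algebra ℂ A] [Superalgebra A]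
  [∀ k, Ring (B k)] [∀ k, Algebra ℂ (B k)] [∀ k, Superalgebra (B k)]
  [∀ k, Ring (C k)] [∀ k, Algebra ℂ (C k)] [∀ k, Superalgebra (C k)]
  [∀ k, Ring (B₁ k)] [∀ k, Algebra ℂ (B₁ k)] [∀ k, Superalgebra (B₁ k)]
  [∀ k, Ring (C₁ k)] [∀ k, Algebra ℂ (C₁ k)] [∀ k, Superalgebra (C₁ k)]

theorem map_superCommutator {D : Type*} [Ring D] [Algebra ℂ D] [Superalgebra D] (f : A →ₐ[ℂ] D)
    (hf : ∀ i, ∀ a ∈ Superspace.part (V := A) i, f a ∈ Superspace.part (V := D) i) (x y : A) :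
    f (superCommutator A x y) = superCommutator D (f x) (f y) := by
  have hproj (i : ZMod 2) (a : A) : f (proj i a) = proj i (f a) := map_proj f.toLinearMap hf i a
  simp only [superCommutator, LinearMap.sub_apply, LinearMap.mul_apply', LinearMap.sum_apply,
    LinearMap.smul_apply, LinearMap.compl₁₂_apply, LinearMap.flip_apply, map_sub, map_mul,
    map_sum, map_smul, hproj]

/-- An isomorphism of superalgebras onto a product, considered as an isomorphism of Lie
superalgebras. Taking `Lie` of each factor, instead of the product, keeps the target of the
isomorphism a direct sum of Lie superalgebras. -/
def SuperalgEquiv.toLie (e : SuperalgEquiv A ((∀ k, B k) × (∀ k, C k))) :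
    LieSuperEquiv (LieOf A) ((∀ k, LieOf (B k)) × (∀ k, LieOf (C k))) where
  toLinearEquiv := (LieOf.of (A := A)).symm ≪≫ₗ e.toAlgEquiv.toLinearEquiv ≪≫ₗ
    (LinearEquiv.piCongrRight fun k => LieOf.of (A := B k)).prodCongr
      (LinearEquiv.piCongrRight fun k => LieOf.of (A := C k))
  map_part := e.map_part
  map_bracket x y := by
    let f : A →ₐ[ℂ] (∀ k, B k) × (∀ k, C k) := e.toAlgEquiv
    refine Prod.ext (funext fun k => ?_) (funext fun k => ?_)
    · exact map_superCommutator ((Pi.evalAlgHom ℂ B k).comp ((AlgHom.fst ℂ _ _).comp f))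
        (fun i a ha => (e.map_part i a ha).1 k trivial) x y
    · exact map_superCommutator ((Pi.evalAlgHom ℂ C k).comp ((AlgHom.snd ℂ _ _).comp f))
        (fun i a ha => (e.map_part i a ha).2 k trivial) x y

/-- The composition of an isomorphism of superalgebras onto a product with isomorphisms of the
factors. -/
def SuperalgEquiv.transProd (e : SuperalgEquiv A ((∀ k, B k) × (∀ k, C k)))
    (q : ∀ k, SuperalgEquiv (B k) (B₁ k)) (m : ∀ k, SuperalgEquiv (C k) (C₁ k)) :
    SuperalgEquiv A ((∀ k, B₁ k) × (∀ k, C₁ k)) where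
  toAlgEquiv := e.toAlgEquiv.trans
    ((AlgEquiv.piCongrRight fun k => (q k).toAlgEquiv).prodCongr
      (AlgEquiv.piCongrRight fun k => (m k).toAlgEquiv))
  map_part i a ha := ⟨fun k _ => (q k).map_part i _ ((e.map_part i a ha).1 k trivial),
    fun k _ => (m k).map_part i _ ((e.map_part i a ha).2 k trivial)⟩

end LieIsomorphisms

section Matrices

variable {V : Type*} [AddCommGroup V] [Module ℂ V] [Superspace V] {m k : ℕ}

theorem repr_eq_zero_of_mem_part (b : Module.Basis (Fin m ⊕ Fin k) ℂ V)
    (hb : ∀ r, b r ∈ Superspace.part (V := V) (blockDeg r)) {j : ZMod 2} {v : V}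
    (hv : v ∈ Superspace.part (V := V) j) {r : Fin m ⊕ Fin k} (hr : blockDeg r ≠ j) :
    b.repr v r = 0 := by
  have hproj : b.coord r ∘ₗ proj j = 0 := by
    refine b.ext fun c => ?_
    rw [LinearMap.comp_apply, LinearMap.zero_apply]
    by_cases hc : blockDeg c = j
    · have hcr : r ≠ c := fun h => hr (h ▸ hc)
      rw [proj_of_mem (hc ▸ hb c), Module.Basis.coord_apply, Module.Basis.repr_self,
        Finsupp.single_eq_of_ne hcr]
    · rw [proj_of_mem_ne (Ne.symm hc) (hb c), map_zero]
  have hv' := LinearMap.congr_fun hproj v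
  rwa [LinearMap.comp_apply, proj_of_mem hv] at hv'

/-- The isomorphism `End(V) ≅ M(m|k)` that sends an endomorphism to its matrix in a homogeneous
basis, whose even elements come first. -/
def endEquivMSuper (b : Module.Basis (Fin m ⊕ Fin k) ℂ V)
    (hb : ∀ r, b r ∈ Superspace.part (V := V) (blockDeg r)) :
    SuperalgEquiv (Module.End ℂ V) (MSuper m k) where
  toAlgEquiv := LinearMap.toMatrixAlgEquiv b
  map_part i f hf r c hrc := by
    refine (LinearMap.toMatrixAlgEquiv_apply b f r c).trans ?_
    refine repr_eq_zero_of_mem_part b hb (hf _ _ (hb c)) fun h => hrc ?_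
    rw [h, add_assoc, CharTwo.add_self_eq_zero, add_zero]

theorem mem_QSuper_iff_commute (M : MSuper m m) :
    M ∈ QSuper m ↔ Commute (Matrix.fromBlocks 0 1 1 0) M := by
  constructor
  · rintro ⟨A, B, rfl⟩
    simp [commute_iff_eq, Matrix.fromBlocks_multiply]
  · intro h
    rw [commute_iff_eq, ← Matrix.fromBlocks_toBlocks M] at h
    simp only [Matrix.fromBlocks_multiply, zero_mul, one_mul, mul_zero, mul_one, zero_add,
      add_zero, Matrix.fromBlocks_inj] at h
    refine ⟨M.toBlocks₁₁, M.toBlocks₁₂, ?_⟩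
    nth_rw 1 [← Matrix.fromBlocks_toBlocks M]
    rw [h.1, h.2.1]

theorem mem_QEnd_iff_commute (J : OddInvolution V) (θ : Module.End ℂ V) :
    θ ∈ QEnd J ↔ Commute J.toEnd θ := by
  simp only [QEnd, Subalgebra.mem_centralizer_iff, Set.mem_singleton_iff, forall_eq,
    commute_iff_eq]

theorem toMatrixAlgEquiv_mem_QSuper_iff (J : OddInvolution V)
    (b : Module.Basis (Fin m ⊕ Fin m) ℂ V) (hJ : ∀ r, J.toEnd (b r) = b r.swap)
    (θ : Module.End ℂ V) : LinearMap.toMatrixAlgEquiv b θ ∈ QSuper m ↔ θ ∈ QEnd J := by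
  have hswap : LinearMap.toMatrixAlgEquiv b J.toEnd = Matrix.fromBlocks 0 1 1 0 := by
    ext r c
    rw [LinearMap.toMatrixAlgEquiv_apply, hJ, Module.Basis.repr_self]
    rcases r with r | r <;> rcases c with c | c <;>
      simp [Finsupp.single_apply, Matrix.one_apply, eq_comm]
  rw [mem_QSuper_iff_commute, mem_QEnd_iff_commute, ← hswap]
  exact commute_map_iff (LinearMap.toMatrixAlgEquiv b).injective

/-- The isomorphism `Q(V, J) ≅ Q(m)` that sends an endomorphism to its matrix in a homogeneous
basis in which `J` is the block matrix `[0 1; 1 0]`. -/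
def qEndEquivQSuper (J : OddInvolution V) (b : Module.Basis (Fin m ⊕ Fin m) ℂ V)
    (hb : ∀ r, b r ∈ Superspace.part (V := V) (blockDeg r))
    (hJ : ∀ r, J.toEnd (b r) = b r.swap) : SuperalgEquiv (QEnd J) (QSuper m) where
  toAlgEquiv := ((LinearMap.toMatrixAlgEquiv b).subalgebraMap (QEnd J)).trans
    (Subalgebra.equivOfEq _ _ <| by
      ext M
      obtain ⟨θ, rfl⟩ := (LinearMap.toMatrixAlgEquiv b).surjective M
      rw [toMatrixAlgEquiv_mem_QSuper_iff J b hJ]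
      exact (LinearMap.toMatrixAlgEquiv b).injective.mem_set_image)
  map_part i θ hθ := (endEquivMSuper b hb).map_part i θ.1 hθ

theorem exists_homogeneous_basis [FiniteDimensional ℂ V]
    (h₀ : Module.finrank ℂ (Superspace.part (V := V) 0) = m)
    (h₁ : Module.finrank ℂ (Superspace.part (V := V) 1) = k) :
    ∃ b : Module.Basis (Fin m ⊕ Fin k) ℂ V, ∀ r, b r ∈ Superspace.part (V := V) (blockDeg r) := by
  refine ⟨((Module.finBasisOfFinrankEq ℂ _ h₀).prod (Module.finBasisOfFinrankEq ℂ _ h₁)).map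
    (Submodule.prodEquivOfIsCompl _ _ Superspace.isCompl), ?_⟩
  rintro (r | r) <;> simp [blockDeg]

/-- The isomorphism `V₀ ≅ V₁` of the homogeneous parts given by an odd map that squares to the
identity. -/
def oddPartEquiv (f : Module.End ℂ V) (hf : f ∈ Superspace.part (V := Module.End ℂ V) 1)
    (hff : f * f = 1) : Superspace.part (V := V) 0 ≃ₗ[ℂ] Superspace.part (V := V) 1 :=
  LinearEquiv.ofLinearMap (f.restrict (hf 0)) (f.restrict (hf 1))
    (LinearMap.ext fun v => Subtype.ext (LinearMap.congr_fun hff v))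
    (LinearMap.ext fun v => Subtype.ext (LinearMap.congr_fun hff v))

theorem exists_homogeneous_basis_oddInvolution [FiniteDimensional ℂ V] (J : OddInvolution V)
    (h₀ : Module.finrank ℂ (Superspace.part (V := V) 0) = m) :
    ∃ b : Module.Basis (Fin m ⊕ Fin m) ℂ V,
      (∀ r, b r ∈ Superspace.part (V := V) (blockDeg r)) ∧ ∀ r, J.toEnd (b r) = b r.swap := by
  let e := oddPartEquiv J.toEnd J.odd J.sq
  have he (v : Superspace.part (V := V) 0) : (e v : V) = J.toEnd v := rfl
  let b₀ := Module.finBasisOfFinrankEq ℂ _ h₀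
  let b := (b₀.prod (b₀.map e)).map (Submodule.prodEquivOfIsCompl _ _ Superspace.isCompl)
  have hl (i : Fin m) : b (Sum.inl i) = b₀ i := by simp [b]
  have hr (i : Fin m) : b (Sum.inr i) = J.toEnd (b₀ i) := by simp [b, he]
  refine ⟨b, ?_, ?_⟩
  · rintro (i | i)
    · rw [hl]
      exact (b₀ i).2
    · rw [hr, ← he]
      exact (e (b₀ i)).2
  · rintro (i | i)
    · rw [hl, Sum.swap_inl, hr]
    · rw [hr, Sum.swap_inr, hl, ← Module.End.mul_apply, J.sq, Module.End.one_apply]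

end Matrices

section Supermodules

open MonoidAlgebra (single)

theorem ksign_add (i j : ZMod 2) : ksign (i + j) 1 = ksign i 1 * ksign j 1 := by
  obtain ⟨-, h₀, -, h₁⟩ := ksign_cases
  have hz : ∀ i : ZMod 2, i = 0 ∨ i = 1 := by decide
  rcases hz i with rfl | rfl <;> rcases hz j with rfl | rfl <;>
    simp [h₀, h₁, CharTwo.add_self_eq_zero (1 : ZMod 2)]

theorem ksign_mul_self (i : ZMod 2) : ksign i 1 * ksign i 1 = 1 := by
  rw [← ksign_add, CharTwo.add_self_eq_zero, ksign_cases.2.1]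

theorem ksign_ne_zero (i : ZMod 2) : ksign i 1 ≠ 0 := left_ne_zero_of_mul_eq_one (ksign_mul_self i)

theorem exists_mem_part_ne_zero_of_ne_bot {A V : Type*} [Ring A] [AddCommGroup V] [Module ℂ V]
    [Superspace V] [Module A V] {U : Submodule A V} (hU : ∀ u ∈ U, ∀ i, proj i u ∈ U)
    (hU0 : U ≠ ⊥) : ∃ i, ∃ w ∈ U, w ∈ Superspace.part (V := V) i ∧ w ≠ 0 := by
  obtain ⟨u, hu, hu0⟩ := U.exists_mem_ne_zero_of_ne_bot hU0
  by_contra! h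
  refine hu0 ?_
  rw [← proj_zero_add_proj_one u, h 0 _ (hU u hu 0) (proj_mem 0 u),
    h 1 _ (hU u hu 1) (proj_mem 1 u), add_zero]

variable {n : ℕ}

theorem signChar_eq_ksign (σ : Equiv.Perm (Fin n)) : signChar n σ = ksign (permDeg σ) 1 := by
  obtain ⟨-, h₀, -, h₁⟩ := ksign_cases
  rcases Int.units_eq_one_or (Equiv.Perm.sign σ) with h | h <;>
    simp [signChar_apply, permDeg, h, h₀, h₁]

theorem twist_signChar_of_mem_part {i : ZMod 2} {a : CS n}
    (ha : a ∈ Superspace.part (V := CS n) i) : twist (signChar n) a = ksign i 1 • a := by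
  ext σ
  rw [coeff_twist, signChar_eq_ksign, MonoidAlgebra.coeff_smul, Finsupp.smul_apply, smul_eq_mul,
    mul_comm]
  by_cases hσ : permDeg σ = i
  · rw [hσ]
  · rw [ha σ hσ, mul_zero, mul_zero]

theorem single_mem_part (σ : Equiv.Perm (Fin n)) :
    (single σ 1 : CS n) ∈ Superspace.part (V := CS n) (permDeg σ) :=
  fun _ hτ => Finsupp.single_eq_of_ne fun h => hτ (congrArg permDeg h)

theorem lsmul_mem_part {A V : Type*} [Ring A] [Algebra ℂ A] [Superalgebra A] [AddCommGroup V]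
    [Module ℂ V] [Superspace V] [Module A V] [IsScalarTower ℂ A V] (hV : IsSupermodule A V)
    {i : ZMod 2} {a : A} (ha : a ∈ Superspace.part (V := A) i) :
    Algebra.lsmul ℂ ℂ V a ∈ Superspace.part (V := Module.End ℂ V) i :=
  fun j v hv => hV i j a v ha hv

/-- A transposition acts as an odd involution. -/
theorem finrank_part_zero_eq_finrank_part_one {V : Type*} [AddCommGroup V] [Module ℂ V]
    [Superspace V] [Module (CS n) V] [IsScalarTower ℂ (CS n) V] (hn : 2 ≤ n)
    (hV : IsSupermodule (CS n) V) :
    Module.finrank ℂ (Superspace.part (V := V) 0) =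
      Module.finrank ℂ (Superspace.part (V := V) 1) := by
  have : Nontrivial (Fin n) := Fin.nontrivial_iff_two_le.2 hn
  obtain ⟨i, j, hij⟩ := exists_pair_ne (Fin n)
  have hdeg : permDeg (Equiv.swap i j) = 1 := by
    rw [permDeg, Equiv.Perm.sign_swap hij, if_neg (by decide)]
  refine (oddPartEquiv (Algebra.lsmul ℂ ℂ V (single (Equiv.swap i j) 1 : CS n))
    (hdeg ▸ lsmul_mem_part hV (single_mem_part _)) ?_).finrank_eq
  rw [← map_mul, MonoidAlgebra.single_mul_single, Equiv.swap_mul_self, mul_one,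
    ← MonoidAlgebra.one_def, map_one]

variable {T : ∀ l : Ptn n, Tableau l} (φ : Associator T) {l : Ptn n}

theorem Associator.map_smul_eq_twist_smul (a : CS n) (v : Specht (T l)) :
    φ.toFun l (a • v) = twist (signChar n) a • φ.toFun l v := by
  induction a using MonoidAlgebra.induction_linear with
  | zero => rw [map_zero, zero_smul, zero_smul, map_zero]
  | add a b ha hb => rw [map_add, add_smul, add_smul, map_add, ha, hb]
  | single σ r =>
    rw [twist_single, single_eq_smul_single_one, single_eq_smul_single_one σ (r * _), smul_assoc,
      map_smul, φ.intertwines, smul_assoc, mul_smul, signChar_apply]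

theorem Associator.map_smul_of_mem_part {i : ZMod 2} {a : CS n}
    (ha : a ∈ Superspace.part (V := CS n) i) (v : Specht (T l)) :
    φ.toFun l (a • v) = ksign i 1 • a • φ.toFun l v := by
  rw [φ.map_smul_eq_twist_smul, twist_signChar_of_mem_part ha, smul_assoc]

variable (l) in
theorem isSupermodule_WE : IsSupermodule (CS n) (WE φ l) := by
  intro i j a w ha hw
  have hw' : w.2 = ksign j 1 • φ.toFun l w.1 := (mem_wePart φ l j w).1 hw
  refine (mem_wePart φ l (i + j) _).2 ?_
  change a • w.2 = ksign (i + j) 1 • φ.toFun l (a • w.1)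
  rw [φ.map_smul_of_mem_part ha, hw', smul_smul, ksign_add, mul_right_comm, ksign_mul_self,
    one_mul, smul_comm]

theorem smul_mem_wfPart {i j : ZMod 2} {a : CS n} {u : Specht (T l)}
    (ha : a ∈ Superspace.part (V := CS n) i) (hu : u ∈ wfPart φ l j) :
    a • u ∈ wfPart φ l (i + j) := by
  have hu' : (φ.toFun l u : CS n) = ksign j 1 • (u : CS n) := hu
  change (φ.toFun l (a • u) : CS n) = ksign (i + j) 1 • ((a • u : Specht (T l)) : CS n)
  rw [φ.map_smul_of_mem_part ha, Submodule.coe_smul_of_tower, Submodule.coe_smul, hu',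
    Submodule.coe_smul, ksign_add, mul_smul, smul_eq_mul, smul_eq_mul, mul_smul_comm]

theorem isSupermodule_WF (h : l.conj = l) : IsSupermodule (CS n) (WF φ l h) :=
  fun _ _ _ _ ha hu => smul_mem_wfPart φ ha hu

theorem isTypeM_WF (h : l.conj = l) : IsTypeM (CS n) (WF φ l h) := by
  have hsimple : IsSimpleModule (CS n) (WF φ l h) := isSimpleModule_specht (T l)
  exact ⟨⟨isSupermodule_WF φ h, IsSimpleModule.nontrivial (CS n) _,
    fun U _ => eq_bot_or_eq_top U⟩, hsimple⟩

theorem isTypeQ_WE (h : l.conj ≠ l) : IsTypeQ (CS n) (WE φ l) := by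
  refine ⟨⟨isSupermodule_WE φ l, inferInstanceAs (Nontrivial (Specht (T l) × Specht (T l.conj))),
    fun U hU => or_iff_not_imp_left.2 fun hU0 => ?_⟩,
    not_isSimpleModule_prod (M := Specht (T l)) (N := Specht (T l.conj))⟩
  obtain ⟨i, w, hwU, hwi, hw0⟩ := exists_mem_part_ne_zero_of_ne_bot hU hU0
  have hw : w.2 = ksign i 1 • φ.toFun l w.1 := (mem_wePart φ l i w).1 hwi
  have hw₁ : w.1 ≠ 0 := fun h₁ => hw0 <| Prod.ext h₁ <| by
    rw [hw, h₁, map_zero, smul_zero]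
    rfl
  have hw₂ : w.2 ≠ 0 := fun h₂ => by
    rw [hw, smul_eq_zero_iff_right (ksign_ne_zero i)] at h₂
    exact hw₁ (φ.injective h₂)
  exact eq_top_of_mem_of_isEmpty_linearEquiv (isEmpty_specht_linearEquiv _ _ h.symm) hwU hw₁ hw₂

variable (l)

instance : Module.Finite ℂ (WE φ l) :=
  inferInstanceAs (Module.Finite ℂ (Specht (T l) × Specht (T l.conj)))

instance (h : l.conj = l) : Module.Finite ℂ (WF φ l h) :=
  inferInstanceAs (Module.Finite ℂ (Specht (T l)))

theorem finrank_part_WE (i : ZMod 2) :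
    Module.finrank ℂ (Superspace.part (V := WE φ l) i) = spechtDim T l :=
  LinearMap.finrank_range_of_inj (f := LinearMap.prod LinearMap.id (ksign i 1 • φ.toFun l))
    fun _ _ h => congrArg Prod.fst h

variable {l}

theorem finrank_part_WF_add_self (hn : 2 ≤ n) (h : l.conj = l) :
    Module.finrank ℂ (Superspace.part (V := WF φ l h) 0) +
      Module.finrank ℂ (Superspace.part (V := WF φ l h) 0) = spechtDim T l := by
  nth_rw 2 [finrank_part_zero_eq_finrank_part_one hn (isSupermodule_WF φ h)]
  exact Submodule.finrank_add_eq_of_isCompl Superspace.isCompl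

theorem even_spechtDim (T : ∀ l : Ptn n, Tableau l) (hn : 2 ≤ n) (h : l.conj = l) :
    Even (spechtDim T l) := by
  obtain ⟨φ⟩ := nonempty_associator T
  exact ⟨_, (finrank_part_WF_add_self φ hn h).symm⟩

theorem nonempty_superalgEquiv_QSuper :
    Nonempty (SuperalgEquiv (QEnd (weInvolution φ l)) (QSuper (spechtDim T l))) := by
  obtain ⟨b, hb, hJ⟩ :=
    exists_homogeneous_basis_oddInvolution (weInvolution φ l) (finrank_part_WE φ l 0)
  exact ⟨qEndEquivQSuper _ b hb hJ⟩

theorem nonempty_superalgEquiv_MSuper (hn : 2 ≤ n) (h : l.conj = l) :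
    Nonempty (SuperalgEquiv (Module.End ℂ (WF φ l h))
      (MSuper (spechtDim T l / 2) (spechtDim T l / 2))) := by
  have h₀ : Module.finrank ℂ (Superspace.part (V := WF φ l h) 0) = spechtDim T l / 2 := by
    have := finrank_part_WF_add_self φ hn h
    lia
  have h₁ := (finrank_part_zero_eq_finrank_part_one hn (isSupermodule_WF φ h)).symm.trans h₀
  obtain ⟨b, hb⟩ := exists_homogeneous_basis h₀ h₁
  exact ⟨endEquivMSuper b hb⟩

end Supermodules

section Decomposition

theorem apply_eq_of_commute_prodMap {R X Y : Type*} [Ring R] [AddCommGroup X] [Module R X]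
    [IsAddTorsionFree X] [AddCommGroup Y] [Module R Y] [IsAddTorsionFree Y]
    {θ : Module.End R (X × Y)}
    (hθ : Commute (LinearMap.prodMap LinearMap.id (-LinearMap.id)) θ) (w : X × Y) :
    θ w = ((θ (w.1, 0)).1, (θ (0, w.2)).2) := by
  have h (w : X × Y) : θ (w.1, -w.2) = ((θ w).1, -(θ w).2) := (LinearMap.congr_fun hθ.eq w).symm
  have h₁ : (θ (w.1, 0)).2 = 0 := by
    have := congrArg Prod.snd (h (w.1, 0))
    rw [neg_zero] at this
    exact self_eq_neg.1 this
  have h₂ : (θ (0, w.2)).1 = 0 := by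
    have := congrArg Prod.fst (h (0, w.2))
    rw [← neg_zero (G := X), ← Prod.neg_mk, map_neg, neg_zero] at this
    exact self_eq_neg.1 this.symm
  have hw : θ w = θ (w.1, 0) + θ (0, w.2) := by
    rw [← map_add, Prod.mk_add_mk, add_zero, zero_add]
  rw [hw]
  exact Prod.ext (by rw [Prod.fst_add, h₂, add_zero]) (by rw [Prod.snd_add, h₁, zero_add])

variable {n : ℕ} {P : Set (Ptn n)}

/-- The shapes of the simple summands of the modules `W^l`: both `l` and `l'` for `l ∈ E_n`, and
`l` for `l ∈ F_n`. -/
def summandShape (P : Set (Ptn n)) : (EReps P ⊕ EReps P) ⊕ FReps P → Ptn n :=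
  Sum.elim (Sum.elim (fun l => l.1) fun l => l.1.conj) fun l => l.1

theorem summandShape_bijective (hP : IsConjReps P) : Function.Bijective (summandShape P) := by
  have eq_of_eq_conj {l m : Ptn n} (hl : l ∈ P) (hm : m ∈ P) (h : l = m.conj) : l = m :=
    (hP m).unique ⟨hl, Or.inr h⟩ ⟨hm, Or.inl rfl⟩
  constructor
  · refine ((Subtype.val_injective).sumElim (fun l m h => ?_) fun l m h => ?_).sumElim
      Subtype.val_injective ?_
    · exact Subtype.ext (by rw [← l.1.conj_conj, h, Ptn.conj_conj])
    · exact m.2.2 (h.symm.trans (eq_of_eq_conj l.2.1 m.2.1 h))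
    · rintro (l | l) m h
      · have h : l.1 = m := h
        exact l.2.2 (h ▸ m.2.2)
      · have h : m.1 = l.1.conj := h.symm
        exact l.2.2 (h.symm.trans (eq_of_eq_conj m.2.1 l.2.1 h))
  · intro m
    obtain ⟨l, ⟨hl, hlm⟩, -⟩ := hP m
    obtain rfl | rfl : m = l ∨ m = l.conj :=
      hlm.imp Eq.symm fun h => by rw [h, Ptn.conj_conj]
    · by_cases hl' : m.conj = m
      · exact ⟨Sum.inr ⟨m, hl, hl'⟩, rfl⟩
      · exact ⟨Sum.inl (Sum.inl ⟨m, hl, hl'⟩), rfl⟩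
    · by_cases hl' : l.conj = l
      · exact ⟨Sum.inr ⟨l, hl, hl'⟩, hl'.symm⟩
      · exact ⟨Sum.inl (Sum.inr ⟨l, hl, hl'⟩), rfl⟩

theorem actionHom_summandShape_bijective (T : ∀ l : Ptn n, Tableau l) (hP : IsConjReps P) :
    Function.Bijective
      (actionHom (k := ℂ) (A := CS n) fun j => Specht (T (summandShape P j))) := by
  have hbij := summandShape_bijective hP
  have := fun l => isSimpleModule_specht (T l)
  refine actionHom_bijective (fun i j hij => isEmpty_specht_linearEquiv _ _ (hbij.injective.ne hij))
    ?_ (by simp [Fintype.card_ne_zero])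
  rw [Nat.card_congr (Equiv.ofBijective _ hbij)]
  exact card_conjClasses_perm_le_card_ptn n

variable {T : ∀ l : Ptn n, Tableau l} (φ : Associator T)

theorem lsmul_mem_QEnd (l : Ptn n) (a : CS n) :
    Algebra.lsmul ℂ ℂ (WE φ l) a ∈ QEnd (weInvolution φ l) :=
  (mem_QEnd_iff_commute _ _).2 <| LinearMap.ext fun w => Prod.ext rfl (smul_neg a w.2).symm

theorem QEnd_weInvolution_apply {l : Ptn n} {θ : Module.End ℂ (WE φ l)}
    (hθ : θ ∈ QEnd (weInvolution φ l)) (w : WE φ l) :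
    θ w = ((θ (w.1, 0)).1, (θ (0, w.2)).2) := by
  have (m : Ptn n) : IsAddTorsionFree (Specht (T m)) := .of_isTorsionFree ℂ _
  exact apply_eq_of_commute_prodMap (X := Specht (T l)) (Y := Specht (T l.conj))
    ((mem_QEnd_iff_commute (weInvolution φ l) θ).1 hθ) w

/-- The map `σ ↦ ⨁ W^l(σ)`, extended linearly to the group algebra. -/
def superActionHom (P : Set (Ptn n)) :
    CS n →ₐ[ℂ] (∀ l : EReps P, QW φ l) × (∀ l : FReps P, EndW φ l) :=
  AlgHom.prod
    (AlgHom.pi fun l => (Algebra.lsmul ℂ ℂ (WE φ l.1)).codRestrict (QW φ l) (lsmul_mem_QEnd φ l.1))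
    (AlgHom.pi fun l => Algebra.lsmul ℂ ℂ (WF φ l.1 l.2.2))

theorem superActionHom_injective (hP : IsConjReps P) :
    Function.Injective (superActionHom φ P) := by
  refine (injective_iff_map_eq_zero _).2 fun a ha => ?_
  have hE (l : EReps P) (w : WE φ l.1) : a • w = 0 :=
    LinearMap.congr_fun (congrArg Subtype.val (congrFun (congrArg Prod.fst ha) l)) w
  have hF (l : FReps P) (w : WF φ l.1 l.2.2) : a • w = 0 :=
    LinearMap.congr_fun (congrFun (congrArg Prod.snd ha) l) w
  refine (injective_iff_map_eq_zero _).1 (actionHom_summandShape_bijective T hP).injective a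
    (funext fun j => LinearMap.ext fun v => ?_)
  rcases j with (l | l) | l
  · exact congrArg Prod.fst (hE l (v, 0))
  · exact congrArg Prod.snd (hE l (0, v))
  · exact hF l v

theorem superActionHom_surjective (hP : IsConjReps P) :
    Function.Surjective (superActionHom φ P) := by
  rintro ⟨θ, η⟩
  let f : ∀ j, Module.End ℂ (Specht (T (summandShape P j)))
    | .inl (.inl l) => LinearMap.fst ℂ _ _ ∘ₗ (θ l).1 ∘ₗ LinearMap.inl ℂ _ _
    | .inl (.inr l) => LinearMap.snd ℂ _ _ ∘ₗ (θ l).1 ∘ₗ LinearMap.inr ℂ _ _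
    | .inr l => η l
  obtain ⟨a, ha⟩ := (actionHom_summandShape_bijective T hP).surjective f
  have ha' (j) (v : Specht (T (summandShape P j))) : a • v = f j v :=
    LinearMap.congr_fun (congrFun ha j) v
  refine ⟨a, Prod.ext (funext fun l => Subtype.ext (LinearMap.ext fun w => ?_))
    (funext fun l => LinearMap.ext (ha' (.inr l)))⟩
  refine Eq.trans ?_ (QEnd_weInvolution_apply φ (θ l).2 w).symm
  exact Prod.ext (ha' (.inl (.inl l)) w.1) (ha' (.inl (.inr l)) w.2)

/-- The group superalgebra as a product of the superalgebras `Q(W^l)` and `End(W^l)`. -/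
def actionEquiv (hP : IsConjReps P) :
    SuperalgEquiv (CS n) ((∀ l : EReps P, QW φ l) × (∀ l : FReps P, EndW φ l)) where
  toAlgEquiv := AlgEquiv.ofBijective (superActionHom φ P)
    ⟨superActionHom_injective φ hP, superActionHom_surjective φ hP⟩
  map_part _ _ ha := ⟨fun l _ => lsmul_mem_part (isSupermodule_WE φ l.1) ha,
    fun l _ => lsmul_mem_part (isSupermodule_WF φ l.2.2) ha⟩

end Decomposition

end SymSuper
end

theorem mainTheorem3 (n : ℕ) (hn : 2 ≤ n) (P : Set (Ptn n)) (hP : IsConjReps P)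
    (T : ∀ l : Ptn n, Tableau l) :
    Nonempty (Associator T) ∧
    ∀ φ : Associator T,
      (∀ l : EReps P, IsTypeQ (CS n) (WE φ l.1)) ∧
      (∀ l : FReps P, IsTypeM (CS n) (WF φ l.1 l.2.2)) ∧
      (∀ l : FReps P, Even (spechtDim T l.1)) ∧
      -- the superalgebra isomorphisms
      ∃ (e : SuperalgEquiv (CS n) ((∀ l : EReps P, QW φ l) × (∀ l : FReps P, EndW φ l)))
        (q : ∀ l : EReps P, SuperalgEquiv (QW φ l) (QSuper (spechtDim T l.1)))
        (m : ∀ l : FReps P, SuperalgEquiv (EndW φ l)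
          (MSuper (spechtDim T l.1 / 2) (spechtDim T l.1 / 2)))
        (e' : SuperalgEquiv (CS n) ((∀ l : EReps P, QSuper (spechtDim T l.1)) ×
          (∀ l : FReps P, MSuper (spechtDim T l.1 / 2) (spechtDim T l.1 / 2))))
        -- the Lie superalgebra isomorphisms
        (g : LieSuperEquiv (LieOf (CS n))
          ((∀ l : EReps P, LieOf (QW φ l)) × (∀ l : FReps P, LieOf (EndW φ l))))
        (g' : LieSuperEquiv (LieOf (CS n)) ((∀ l : EReps P, LieOf (QSuper (spechtDim T l.1))) ×
          (∀ l : FReps P, LieOf (MSuper (spechtDim T l.1 / 2) (spechtDim T l.1 / 2))))),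
        (∀ (a : CS n) (l : EReps P) (w : WE φ l.1),
          ((e.toAlgEquiv a).1 l : Module.End ℂ (WE φ l.1)) w = a • w) ∧
        (∀ (a : CS n) (l : FReps P) (w : WF φ l.1 l.2.2), (e.toAlgEquiv a).2 l w = a • w) ∧
        (∀ (a : CS n) (l : EReps P),
          (e'.toAlgEquiv a).1 l = (q l).toAlgEquiv ((e.toAlgEquiv a).1 l)) ∧
        (∀ (a : CS n) (l : FReps P),
          (e'.toAlgEquiv a).2 l = (m l).toAlgEquiv ((e.toAlgEquiv a).2 l)) ∧
        (∀ (a : CS n) (l : EReps P),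
          (g.toLinearEquiv (LieOf.of a)).1 l = LieOf.of ((e.toAlgEquiv a).1 l)) ∧
        (∀ (a : CS n) (l : FReps P),
          (g.toLinearEquiv (LieOf.of a)).2 l = LieOf.of ((e.toAlgEquiv a).2 l)) ∧
        (∀ (a : CS n) (l : EReps P),
          (g'.toLinearEquiv (LieOf.of a)).1 l = LieOf.of ((e'.toAlgEquiv a).1 l)) ∧
        (∀ (a : CS n) (l : FReps P),
          (g'.toLinearEquiv (LieOf.of a)).2 l = LieOf.of ((e'.toAlgEquiv a).2 l)) := by
  refine ⟨nonempty_associator T, fun φ => ⟨fun l => isTypeQ_WE φ l.2.2,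
    fun l => isTypeM_WF φ l.2.2, fun l => even_spechtDim T hn l.2.2, ?_⟩⟩
  let e := actionEquiv φ hP
  let q (l : EReps P) := (nonempty_superalgEquiv_QSuper φ (l := l.1)).some
  let m (l : FReps P) := (nonempty_superalgEquiv_MSuper φ hn l.2.2).some
  exact ⟨e, q, m, e.transProd q m, e.toLie, (e.transProd q m).toLie,
    fun _ _ _ => rfl, fun _ _ _ => rfl, fun _ _ => rfl, fun _ _ => rfl,
    fun _ _ => rfl, fun _ _ => rfl, fun _ _ => rfl, fun _ _ => rfl⟩
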